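/- **Caching in Matchings.** Let $V^{in}$ and $V^{out}$ be two disjoint sets of $n$ nodes each. A cache configuration consists of $k$ matchings of the complete bipartite graph on $V^{in}\cup V^{out}$; an edge is cached if it lies in at least one of the $k$ matchings. Initially all matchings are empty. Requests are edges in $V^{in}\times V^{out}$ that arrive one at a time; when an edge is requested, the configuration may be changed arbitrarily, subject to the requested edge being cached afterwards. Each insertion of an edge into a matching costs $1$ (in particular, moving an edge to another matching costs $1$), and evictions are free. Let $OPT(\sigma)$ be the minimum total cost of serving the finite request sequence $\sigma$ offline. In a deterministic online algorithm the configuration after each request is determined by the requests that have arrived so far; a (randomized) online algorithm is a random deterministic online algorithm. For given $n,k$, an online algorithm $A$ is $c$-competitive ($c\in\mathbb{R}$) if there is a number $d$ such that $\mathbb{E}[cost(A(\sigma))]\le c\cdot OPT(\sigma)+d$ for all request sequences $\sigma$. **Statement.** 1. There is an absolute constant $C>0$ such that for all integers $2\le k<n$, if an online algorithm (deterministic or randomized) for Caching in Matchings with parameters $n,k$ is $c$-competitive, then $c\ge C\log n$. 2. There is an absolute constant $C>0$ such that for all reals $\epsilon>0$ and $K>0$ there is an $N$ for which the following holds: for all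 integers $n\ge N$ and $2\le k<n$ with $k\le K\,n^{1/2-\epsilon}$, if an online algorithm (deterministic or randomized) with parameters $n,k$ is $c$-competitive, then $c\ge C\,\epsilon\,\log n\,\log k$. 3. There is an absolute constant $C>0$ such that for all integers $2\le k<n$, if a deterministic online algorithm with parameters $n,k$ is $c$-competitive, then $c\ge C\max\{n/k,\,k\}$. -/

import Mathlib

open MeasureTheory

universe u

namespace CachingInMatchings

/-- An edge `(u, v)` joins the node `u` of the side `V^in` to the node `v` of the side `V^out`;
each side has `n` nodes. -/
abbrev Edge (n : ℕ) : Type := Fin n × Fin n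

/-- A set of edges is a matching if no two different edges of it share a node. -/
def IsMatching {n : ℕ} (M : Finset (Edge n)) : Prop :=
  Set.InjOn Prod.fst (M : Set (Edge n)) ∧ Set.InjOn Prod.snd (M : Set (Edge n))

/-- A cache configuration: `k` matchings (the matching number `i` is the colour class `i`). -/
@[ext]
structure Cache (n k : ℕ) where
  matching : Fin k → Finset (Edge n)
  isMatching : ∀ i, IsMatching (matching i)

namespace Cache

variable {n k : ℕ}

/-- The cache in which all matchings are empty. -/
def empty (n k : ℕ) : Cache n k where
  matching := fun _ => ∅
  isMatching := fun _ => by simp [IsMatching]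

/-- The edge `e` is cached, i.e. it is in the union of the matchings. -/
def Contains (S : Cache n k) (e : Edge n) : Prop :=
  ∃ i, e ∈ S.matching i

/-- The cost of passing from the configuration `S` to the configuration `T`: every insertion of an
edge into a matching costs `1` (so moving an edge to another matching costs `1`), and evictions are
free. -/
def switchCost (S T : Cache n k) : ℕ :=
  ∑ i, (T.matching i \ S.matching i).card

end Cache

variable {n k : ℕ}

/-- `S` is a feasible way to serve the request sequence `σ`: the cache is initially empty, and it
contains the request number `i` in the configuration `S (i + 1)` that results from serving it. -/
def IsSchedule (σ : List (Edge n)) (S : ℕ → Cache n k) : Prop :=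
  S 0 = Cache.empty n k ∧ ∀ (i : ℕ) (h : i < σ.length), (S (i + 1)).Contains σ[i]

/-- The total number of fetched edges while `σ` is served through the configurations `S`. -/
def scheduleCost (σ : List (Edge n)) (S : ℕ → Cache n k) : ℕ :=
  ∑ i ∈ Finset.range σ.length, (S i).switchCost (S (i + 1))

/-- The optimal offline cost of serving `σ` with `k` matchings. -/
noncomputable def optCost (k : ℕ) (σ : List (Edge n)) : ℕ :=
  sInf {m : ℕ | ∃ S : ℕ → Cache n k, IsSchedule σ S ∧ scheduleCost σ S = m}

/-- A deterministic online algorithm for `n` nodes per side and `k` matchings: the configuration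
after each request is determined by the requests that have arrived so far. -/
structure DetAlg (n k : ℕ) where
  state : List (Edge n) → Cache n k
  state_nil : state [] = Cache.empty n k
  serves : ∀ (σ : List (Edge n)) (e : Edge n), (state (σ ++ [e])).Contains e

/-- The number of edges fetched by a deterministic algorithm on `σ`. -/
def DetAlg.cost (A : DetAlg n k) (σ : List (Edge n)) : ℕ :=
  scheduleCost σ (fun i => A.state (σ.take i))

/-- `A` is `c`-competitive: its cost is at most `c` times the optimum, up to an additive term that
does not depend on the request sequence. -/
def DetAlg.IsCompetitive (A : DetAlg n k) (c : ℝ) : Prop :=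
  ∃ d : ℝ, ∀ σ : List (Edge n), (A.cost σ : ℝ) ≤ c * (optCost k σ : ℝ) + d

/-- A (randomized) online algorithm: a random deterministic online algorithm, on an arbitrary
probability space. -/
structure RandAlg (n k : ℕ) : Type (u + 1) where
  Ω : Type u
  [measurableSpace : MeasurableSpace Ω]
  prob : Measure Ω
  [isProbabilityMeasure : IsProbabilityMeasure prob]
  alg : Ω → DetAlg n k
  measurable_state : ∀ (σ : List (Edge n)) (S : Cache n k),
    MeasurableSet {ω | (alg ω).state σ = S}

attribute [instance] RandAlg.measurableSpace RandAlg.isProbabilityMeasure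

/-- The expected number of edges fetched by a randomized algorithm on `σ`. -/
noncomputable def RandAlg.expectedCost (A : RandAlg.{u} n k) (σ : List (Edge n)) : ℝ :=
  ∫ ω, ((A.alg ω).cost σ : ℝ) ∂A.prob

/-- `A` is `c`-competitive (against oblivious adversaries): for every fixed request sequence its
expected cost is at most `c` times the optimum, up to an additive term that does not depend on the
request sequence. -/
def RandAlg.IsCompetitive (A : RandAlg.{u} n k) (c : ℝ) : Prop :=
  ∃ d : ℝ, ∀ σ : List (Edge n), A.expectedCost σ ≤ c * (optCost k σ : ℝ) + d

/-- There are finitely many cache configurations. -/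
instance Cache.instFinite : Finite (Cache n k) :=
  Finite.of_injective (fun S : Cache n k => S.matching) fun _ _ h => Cache.ext h

/-- The cost of a randomized algorithm on a fixed sequence is integrable, so `expectedCost` is a
genuine expectation. -/
theorem RandAlg.integrable_cost (A : RandAlg.{u} n k) (σ : List (Edge n)) :
    Integrable (fun ω => ((A.alg ω).cost σ : ℝ)) A.prob := by
  let _ : MeasurableSpace (Cache n k) := ⊤
  have hd : DiscreteMeasurableSpace (Cache n k) := ⟨fun _ => trivial⟩
  have hs : ∀ τ, Measurable (fun ω => (A.alg ω).state τ) := fun τ =>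
    measurable_to_countable' fun S => A.measurable_state τ S
  simp only [DetAlg.cost, scheduleCost, Nat.cast_sum]
  refine integrable_finsetSum _ fun i _ => ?_
  obtain ⟨B, hB⟩ :=
    (Set.finite_range fun p : Cache n k × Cache n k => ‖(p.1.switchCost p.2 : ℝ)‖).bddAbove
  have hm : Measurable fun p : Cache n k × Cache n k => (p.1.switchCost p.2 : ℝ) :=
    measurable_of_countable _
  refine Integrable.of_bound
    (hm.comp ((hs (σ.take i)).prodMk (hs (σ.take (i + 1))))).aestronglyMeasurable B ?_
  exact Filter.Eventually.of_forall fun ω =>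
    hB ⟨((A.alg ω).state (σ.take i), (A.alg ω).state (σ.take (i + 1))), rfl⟩

end CachingInMatchings

/-!
All three bounds come from an adversary that plays against the algorithm and is compared with an
offline algorithm that knows the whole sequence. Against a randomized algorithm it suffices to
choose the requests greedily: if the average cost over some continuations is large for every
deterministic algorithm, then one of them has large expected cost
(`RandAlg.exists_continuation`). Repeating a list of requests often enough forces an algorithm to
hold the whole list at some moment, or to pay in every round
(`DetAlg.exists_contains_of_rounds`).

*Paging.* The matchings contain at most `k` of `k + 1` edges at a node. This gives `Ω(k)` for
deterministic algorithms and, by the usual phases, `Ω(log k)` for randomized ones.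

*Gadgets.* Take a `k`-regular bipartite graph with at most `2 * k` nodes per side and remove one
edge. If all of the rest is cached, then the same colour is missing at both ends of the removed edge
(`Layout.ContainsGadget.exists_isMissing`), so a chain of such gadgets is a wire that transmits a
colour. To change the colour of a wire, every gadget on it must be changed
(`Layout.card_le_switchCost_of_color_ne`), while for the Cayley graphs of groups of exponent two
boundedly many insertions per gadget suffice (`Layout.switchCost_conf_le`). Two wires are forced to
have the same colour by a connector, and different colours by edges to a common node.

*Deterministic algorithms.* For two wires of about `n / k` gadgets each, these two requirements
alternate, and the adversary requests edges that are absent. The algorithm then pays the length of a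
wire in each period. An offline algorithm that leaves out a fixed connector inside a wire pays a
constant per period, and another constant whenever this connector is requested. On average over the
connectors, and hence for some connector, this is a constant per period.

*Randomized algorithms.* A bundle consists of `k` wires of different colours. Two adjacent bundles
of length `l` are merged along a permutation of the wires that adds a secret vector of
`t = ⌊log₂ k⌋` bits to the indices. A bit is tested by two extra nodes, each of which is joined to
the wires of the first bundle with one value of this bit and to the wires of the second bundle that
have the other value. A random bit is wrong for half of `2 ^ t` wires on average, whatever the
algorithm holds, so each bit costs it of the order of `l * k`
(`DetAlg.le_sum_cost_bitRequests`). The offline algorithm knows all the bits: it gives the gadgets their final colours at the beginning, and pays `O(k)` per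
tested bit for the edges outside of the gadgets. Merging in a binary tree, starting with bundles of
length `t`, costs the algorithm the same amount on each of the `J` levels
(`RandAlg.exists_bundle`), and gives the bound `Ω(J * t)` as long as about `k ^ 2 * t * 2 ^ J` nodes
are available. For `k = O(n ^ (1 / 2 - ε))` this is `Ω(ε * log n * log k)`. The bound `Ω(log n)`
follows from this for `k ≤ n ^ (1 / 4)`, and from paging for larger `k`.
-/

namespace CachingInMatchings

variable {n k : ℕ}

/-! ### Switching costs and costs of online algorithms -/

namespace Cache

theorem switchCost_self (S : Cache n k) : S.switchCost S = 0 := by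
  simp [switchCost]

theorem switchCost_triangle (S T U : Cache n k) :
    S.switchCost U ≤ S.switchCost T + T.switchCost U := by
  classical
  rw [switchCost, switchCost, switchCost, ← Finset.sum_add_distrib]
  refine Finset.sum_le_sum fun i _ => ?_
  rw [add_comm]
  exact (Finset.card_le_card (sdiff_triangle _ (T.matching i) _)).trans (Finset.card_union_le _ _)

theorem matching_subset_of_switchCost_eq_zero {S T : Cache n k} (h : S.switchCost T = 0)
    (i : Fin k) : T.matching i ⊆ S.matching i := by
  rw [switchCost, Finset.sum_eq_zero_iff] at h
  exact Finset.sdiff_eq_empty_iff_subset.1 (Finset.card_eq_zero.1 (h i (Finset.mem_univ i)))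

theorem Contains.of_switchCost_eq_zero {S T : Cache n k} (h : S.switchCost T = 0) {e : Edge n}
    (he : T.Contains e) : S.Contains e :=
  he.imp fun i hi => matching_subset_of_switchCost_eq_zero h i hi

theorem switchCost_eq_card (S T : Cache n k) :
    S.switchCost T =
      (Finset.univ.sigma fun i => T.matching i \ S.matching i).card := by
  rw [Finset.card_sigma, switchCost]

/-- The insertions of a switch may be counted by any finite set covering them. -/
theorem switchCost_le_card {S T : Cache n k} (D : Finset (Fin k × Edge n))
    (hD : ∀ i e, e ∈ T.matching i → e ∉ S.matching i → (i, e) ∈ D) :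
    S.switchCost T ≤ D.card := by
  rw [switchCost_eq_card]
  refine Finset.card_le_card_of_injOn (fun x => (x.1, x.2)) ?_ ?_
  · rintro ⟨i, e⟩ h
    simp only [Finset.coe_sigma, Set.mem_sigma_iff, Finset.coe_sdiff, Set.mem_sdiff] at h
    exact hD i e (by simpa using h.2.1) (by simpa using h.2.2)
  · rintro ⟨i, e⟩ - ⟨j, f⟩ - h
    simp only [Prod.mk.injEq] at h
    obtain ⟨rfl, rfl⟩ := h
    rfl

/-- Distinct insertions give a lower bound for the cost of a switch. -/
theorem card_le_switchCost {α : Type*} {S T : Cache n k} (D : Finset α)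
    (c : α → Fin k) (f : α → Edge n) (hT : ∀ a ∈ D, f a ∈ T.matching (c a))
    (hS : ∀ a ∈ D, f a ∉ S.matching (c a)) (hf : Set.InjOn f D) :
    D.card ≤ S.switchCost T := by
  rw [switchCost_eq_card]
  refine Finset.card_le_card_of_injOn (fun a => ⟨c a, f a⟩) ?_ ?_
  · intro a ha
    simp [hT a ha, hS a ha]
  · intro a ha b hb h
    refine hf ha hb ?_
    simp only [Sigma.mk.injEq] at h
    exact eq_of_heq h.2

theorem switchCost_le_const (S T : Cache n k) : S.switchCost T ≤ k * (n * n) := by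
  refine (switchCost_le_card Finset.univ fun _ _ _ _ => Finset.mem_univ _).trans ?_
  simp

end Cache

namespace DetAlg

variable (A : DetAlg n k)

theorem cost_concat (σ : List (Edge n)) (e : Edge n) :
    A.cost (σ ++ [e]) = A.cost σ + (A.state σ).switchCost (A.state (σ ++ [e])) := by
  simp only [cost, scheduleCost, List.length_append, List.length_singleton]
  rw [Finset.sum_range_succ]
  congr 1
  · refine Finset.sum_congr rfl fun i hi => ?_
    have hi := Finset.mem_range.1 hi
    rw [List.take_append_of_le_length hi.le, List.take_append_of_le_length hi]
  · rw [List.take_append_of_le_length le_rfl, List.take_length, List.take_of_length_le (by simp)]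

theorem cost_add_switchCost_le (σ τ : List (Edge n)) :
    A.cost σ + (A.state σ).switchCost (A.state (σ ++ τ)) ≤ A.cost (σ ++ τ) := by
  induction τ generalizing σ with
  | nil => simp [Cache.switchCost_self]
  | cons e τ ih =>
    have h := ih (σ ++ [e])
    have h2 := (A.state σ).switchCost_triangle (A.state (σ ++ [e])) (A.state (σ ++ [e] ++ τ))
    rw [cost_concat] at h
    simp only [List.append_assoc, List.singleton_append] at h h2 ⊢
    omega

theorem cost_le_append (σ τ : List (Edge n)) : A.cost σ ≤ A.cost (σ ++ τ) :=
  (Nat.le_add_right _ _).trans (A.cost_add_switchCost_le σ τ)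

theorem cost_lt_or_contains (l σ : List (Edge n)) :
    A.cost σ + 1 ≤ A.cost (σ ++ l) ∨ ∀ e ∈ l, (A.state σ).Contains e := by
  induction l generalizing σ with
  | nil => simp
  | cons e l ih =>
    have hc := A.cost_concat σ e
    have hm := A.cost_le_append (σ ++ [e]) l
    rw [List.append_assoc, List.singleton_append] at hm
    rcases Nat.eq_zero_or_pos ((A.state σ).switchCost (A.state (σ ++ [e]))) with h0 | h0
    · rcases ih (σ ++ [e]) with h | h
      · left
        rw [List.append_assoc, List.singleton_append] at h
        omega
      · right
        intro f hf
        rcases List.mem_cons.1 hf with rfl | hf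
        · exact (A.serves σ f).of_switchCost_eq_zero h0
        · exact (h f hf).of_switchCost_eq_zero h0
    · left; omega

end DetAlg

/-- The request sequence `l`, repeated `R` times. -/
def rounds (R : ℕ) (l : List (Edge n)) : List (Edge n) := (List.replicate R l).flatten

theorem mem_of_mem_rounds {R : ℕ} {l : List (Edge n)} {e : Edge n} (h : e ∈ rounds R l) :
    e ∈ l := by
  simp only [rounds, List.mem_flatten, List.mem_replicate] at h
  obtain ⟨l', ⟨_, rfl⟩, he⟩ := h
  exact he

/-- If `l` is requested often enough, an algorithm either pays in every round, or holds all of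
`l` at some moment. -/
theorem DetAlg.exists_contains_of_rounds (A : DetAlg n k) (l : List (Edge n)) (R : ℕ)
    (σ : List (Edge n)) :
    A.cost σ + R ≤ A.cost (σ ++ rounds R l) ∨
      ∃ τ τ', rounds R l = τ ++ τ' ∧ ∀ e ∈ l, (A.state (σ ++ τ)).Contains e := by
  induction R generalizing σ with
  | zero => simp [rounds]
  | succ R ih =>
    have hr : rounds (R + 1) l = l ++ rounds R l := by simp [rounds, List.replicate_succ]
    rcases A.cost_lt_or_contains l σ with h | h
    · rcases ih (σ ++ l) with h' | ⟨τ, τ', he, h'⟩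
      · left
        rw [hr, ← List.append_assoc]
        omega
      · right
        refine ⟨l ++ τ, τ', by rw [hr, he, List.append_assoc], ?_⟩
        simpa only [List.append_assoc] using h'
    · exact Or.inr ⟨[], rounds (R + 1) l, rfl, by simpa using h⟩

/-- The adversary may be greedy: if the average cost over a family of continuations is at least
`X` for every deterministic algorithm, some continuation has expected cost at least `X`. -/
theorem RandAlg.exists_continuation {ι : Type*} [Fintype ι] [Nonempty ι] (A : RandAlg.{u} n k)
    (σ : List (Edge n)) (τ : ι → List (Edge n)) (X : ℝ)
    (h : ∀ D : DetAlg n k,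
      Fintype.card ι * X ≤ ∑ r, ((D.cost (σ ++ τ r) : ℝ) - D.cost σ)) :
    ∃ r, A.expectedCost σ + X ≤ A.expectedCost (σ ++ τ r) := by
  by_contra! hlt
  have h1 : ∑ r, (A.expectedCost (σ ++ τ r) - A.expectedCost σ) < ∑ _r : ι, X :=
    Finset.sum_lt_sum_of_nonempty Finset.univ_nonempty fun r _ => by linarith [hlt r]
  have h2 : ∑ r, (A.expectedCost (σ ++ τ r) - A.expectedCost σ) =
      ∫ ω, ∑ r, (((A.alg ω).cost (σ ++ τ r) : ℝ) - (A.alg ω).cost σ) ∂A.prob := by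
    rw [integral_finsetSum]
    · refine Finset.sum_congr rfl fun r _ => ?_
      rw [integral_sub (A.integrable_cost _) (A.integrable_cost _)]
      rfl
    · exact fun r _ => (A.integrable_cost _).sub (A.integrable_cost _)
  have h3 : ∫ _ω, (Fintype.card ι * X : ℝ) ∂A.prob ≤
      ∫ ω, ∑ r, (((A.alg ω).cost (σ ++ τ r) : ℝ) - (A.alg ω).cost σ) ∂A.prob := by
    refine integral_mono (integrable_const _) ?_ fun ω => h _
    exact integrable_finsetSum _ fun r _ => (A.integrable_cost _).sub (A.integrable_cost _)
  simp only [integral_const, probReal_univ, one_smul] at h3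
  simp only [Finset.sum_const, Finset.card_univ, nsmul_eq_mul] at h1
  linarith

theorem RandAlg.expectedCost_nonneg (A : RandAlg.{u} n k) (σ : List (Edge n)) :
    0 ≤ A.expectedCost σ :=
  integral_nonneg fun _ => Nat.cast_nonneg _

/-! ### Offline schedules -/

/-- `Serves S σ c T`: starting from `S`, the requests `σ` can be served at cost at most `c` so that
the configuration is `T` in the end. Switches may be made at any time; a request is served for free
if the present configuration contains it. -/
inductive Serves : Cache n k → List (Edge n) → ℕ → Cache n k → Prop
  | nil (S : Cache n k) : Serves S [] 0 S
  | move {S T : Cache n k} {σ : List (Edge n)} {c : ℕ} (h : Serves S σ c T) (U : Cache n k)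
      {d : ℕ} (hd : T.switchCost U ≤ d) : Serves S σ (c + d) U
  | request {S T : Cache n k} {σ : List (Edge n)} {c : ℕ} (h : Serves S σ c T) {e : Edge n}
      (he : T.Contains e) : Serves S (σ ++ [e]) c T

namespace Serves

variable {S T U : Cache n k} {σ τ : List (Edge n)} {c d : ℕ}

theorem mono (h : Serves S σ c T) (hcd : c ≤ d) : Serves S σ d T := by
  obtain ⟨e, rfl⟩ := Nat.exists_eq_add_of_le hcd
  exact h.move T (by rw [Cache.switchCost_self]; exact Nat.zero_le _)

theorem trans (h : Serves S σ c T) (h' : Serves T τ d U) : Serves S (σ ++ τ) (c + d) U := by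
  induction h' with
  | nil => simpa using h
  | move _ U hd ih => rw [← add_assoc]; exact ih.move U hd
  | request _ he ih => rw [← List.append_assoc]; exact ih.request he

theorem of_contains (l : List (Edge n)) (h : ∀ e ∈ l, T.Contains e) : Serves T l 0 T := by
  induction l using List.reverseRecOn with
  | nil => exact nil T
  | append_singleton l e ih =>
    exact (ih fun f hf => h f (by simp [hf])).request (h e (by simp))

theorem switch (h : S.switchCost T ≤ d) : Serves S [] d T := by
  simpa using (nil S).move T h

theorem exists_schedule (h : Serves S σ c T) :
    ∃ f : ℕ → Cache n k, f 0 = S ∧ (∀ (i : ℕ) (h : i < σ.length), (f (i + 1)).Contains σ[i]) ∧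
      scheduleCost σ f + (f σ.length).switchCost T ≤ c := by
  induction h with
  | nil => exact ⟨fun _ => S, rfl, by simp, by simp [scheduleCost, Cache.switchCost_self]⟩
  | @move T σ c _ U d hd ih =>
    obtain ⟨f, h0, hf, hc⟩ := ih
    refine ⟨f, h0, hf, ?_⟩
    have := (f σ.length).switchCost_triangle T U
    omega
  | @request T σ c _ e he ih =>
    obtain ⟨f, h0, hf, hc⟩ := ih
    refine ⟨fun i => if i ≤ σ.length then f i else T, by simp [h0], ?_, ?_⟩
    · intro i hi
      simp only [List.length_append, List.length_singleton] at hi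
      rcases Nat.lt_succ_iff_lt_or_eq.1 hi with hlt | rfl
      · simp only [Nat.succ_le_of_lt hlt, if_true]
        rw [List.getElem_append_left hlt]
        exact hf i hlt
      · simpa using he
    · simp only [scheduleCost, List.length_append, List.length_singleton] at hc ⊢
      rw [Finset.sum_range_succ]
      simp only [le_refl, if_true, Nat.not_succ_le_self, if_false, Cache.switchCost_self, add_zero]
      refine le_trans (le_of_eq ?_) hc
      congr 1
      refine Finset.sum_congr rfl fun i hi => ?_
      have hi := Finset.mem_range.1 hi
      simp [hi.le, Nat.succ_le_of_lt hi]

theorem optCost_le (h : Serves (Cache.empty n k) σ c T) : optCost k σ ≤ c := by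
  obtain ⟨f, h0, hf, hc⟩ := h.exists_schedule
  have : optCost k σ ≤ scheduleCost σ f := Nat.sInf_le ⟨f, ⟨h0, hf⟩, rfl⟩
  omega

end Serves

namespace Cache

/-- Insert the edge `e` into the matching number `i`, evicting the edges of that matching that share
a node with `e`. -/
def insertEdge (S : Cache n k) (i : Fin k) (e : Edge n) : Cache n k where
  matching j := if j = i then
    insert e ((S.matching j).filter fun f => f.1 ≠ e.1 ∧ f.2 ≠ e.2) else S.matching j
  isMatching j := by
    have h := S.isMatching j
    by_cases hj : j = i
    · simp only [hj, if_true]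
      rw [hj] at h
      constructor
      · intro a ha b hb hab
        simp only [Finset.coe_insert, Finset.coe_filter, Set.mem_insert_iff, Set.mem_ofPred_eq]
          at ha hb
        rcases ha with rfl | ha <;> rcases hb with rfl | hb
        · rfl
        · exact absurd hab.symm hb.2.1
        · exact absurd hab ha.2.1
        · exact h.1 ha.1 hb.1 hab
      · intro a ha b hb hab
        simp only [Finset.coe_insert, Finset.coe_filter, Set.mem_insert_iff, Set.mem_ofPred_eq]
          at ha hb
        rcases ha with rfl | ha <;> rcases hb with rfl | hb
        · rfl
        · exact absurd hab.symm hb.2.2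
        · exact absurd hab ha.2.2
        · exact h.2 ha.1 hb.1 hab
    · simpa only [hj, if_false] using h

theorem insertEdge_contains (S : Cache n k) (i : Fin k) (e : Edge n) :
    (S.insertEdge i e).Contains e := ⟨i, by simp [insertEdge]⟩

theorem switchCost_insertEdge_le (S : Cache n k) (i : Fin k) (e : Edge n) :
    S.switchCost (S.insertEdge i e) ≤ 1 := by
  refine (switchCost_le_card {(i, e)} fun j f hf hS => ?_).trans (by simp)
  by_cases hj : j = i
  · simp only [insertEdge, hj, if_true, Finset.mem_insert, Finset.mem_filter] at hf
    rcases hf with rfl | hf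
    · simp [hj]
    · rw [hj] at hS
      exact absurd hf.1 hS
  · simp only [insertEdge, hj, if_false] at hf
    exact absurd hf hS

theorem switchCost_insertEdge_back_le (S : Cache n k) (i : Fin k) (e : Edge n) :
    (S.insertEdge i e).switchCost S ≤ 2 := by
  classical
  have h1 : ((S.matching i).filter fun f => f.1 = e.1).card ≤ 1 :=
    Finset.card_le_one.2 fun a ha b hb => by
      rw [Finset.mem_filter] at ha hb
      exact (S.isMatching i).1 ha.1 hb.1 (ha.2.trans hb.2.symm)
  have h2 : ((S.matching i).filter fun f => f.2 = e.2).card ≤ 1 :=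
    Finset.card_le_one.2 fun a ha b hb => by
      rw [Finset.mem_filter] at ha hb
      exact (S.isMatching i).2 ha.1 hb.1 (ha.2.trans hb.2.symm)
  refine (switchCost_le_card ((((S.matching i).filter fun f => f.1 = e.1) ∪
    ((S.matching i).filter fun f => f.2 = e.2)).image fun f => (i, f)) ?_).trans
    (Finset.card_image_le.trans ((Finset.card_union_le _ _).trans (by omega)))
  intro j f hf hS
  by_cases hj : j = i
  · subst hj
    simp only [insertEdge, if_true, Finset.mem_insert, Finset.mem_filter, not_or, hf, true_and]
      at hS
    simp only [Finset.mem_image, Finset.mem_union, Finset.mem_filter]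
    refine ⟨f, ?_, rfl⟩
    tauto
  · simp only [insertEdge, hj, if_false] at hS
    exact absurd hf hS

end Cache

/-- Any request can be served at cost `3` without a lasting change of the configuration. -/
theorem Serves.detour (hk : 0 < k) (T : Cache n k) (e : Edge n) : Serves T [e] 3 T := by
  have h1 := ((Serves.nil T).move _ (T.switchCost_insertEdge_le ⟨0, hk⟩ e)).request
    (T.insertEdge_contains _ _)
  exact h1.move T (T.switchCost_insertEdge_back_le ⟨0, hk⟩ e)

/-- A configuration that contains all requests but `e` serves them at cost `3` per request
of `e`. -/
theorem Serves.of_contains_except (hk : 0 < k) (T : Cache n k) (e : Edge n) (l : List (Edge n))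
    (h : ∀ f ∈ l, f ≠ e → T.Contains f) : Serves T l (3 * l.count e) T := by
  induction l with
  | nil => exact Serves.nil T
  | cons f l ih =>
    have ih := ih fun f' hf' => h f' (by simp [hf'])
    by_cases hf : f = e
    · subst hf
      have := (Serves.detour hk T f).trans ih
      refine Serves.mono (by simpa using this) ?_
      rw [List.count_cons_self]
      omega
    · have := (Serves.of_contains [f] (T := T) (by simpa using h f (by simp) hf)).trans ih
      refine Serves.mono (by simpa using this) ?_
      rw [List.count_cons_of_ne hf]

/-- The limit argument behind all lower bounds: if some sequences force cost `m * X` while the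
optimum is at most `m * Y + D`, the competitive ratio is at least `X / Y`. -/
theorem div_le_of_competitive {cost : List (Edge n) → ℝ} {c d X Y D : ℝ}
    (hc : ∀ σ, cost σ ≤ c * (optCost k σ : ℝ) + d) (hX : 0 < X) (hY : 0 < Y)
    (h : ∀ m : ℕ, ∃ σ, m * X ≤ cost σ ∧ (optCost k σ : ℝ) ≤ m * Y + D) : X / Y ≤ c := by
  rw [div_le_iff₀ hY]
  by_contra! hlt
  rcases le_or_gt 0 c with h0 | h0
  · obtain ⟨m, hm⟩ := exists_nat_gt ((c * D + d) / (X - c * Y))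
    rw [div_lt_iff₀ (by linarith)] at hm
    obtain ⟨σ, h1, h2⟩ := h m
    have h3 := hc σ
    have h4 := mul_le_mul_of_nonneg_left h2 h0
    nlinarith
  · obtain ⟨m, hm⟩ := exists_nat_gt (d / X)
    rw [div_lt_iff₀ hX] at hm
    obtain ⟨σ, h1, -⟩ := h m
    have h3 := hc σ
    have h4 : c * (optCost k σ : ℝ) ≤ 0 := mul_nonpos_of_nonpos_of_nonneg h0.le (Nat.cast_nonneg _)
    linarith

/-! ### Gadgets that transmit a colour -/

/-- A placement of gadgets and of extra nodes in the graph. The gadgets are indexed by `Γ`; each has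
the nodes `(g, h)`, `h : H`, on either side, where `H` is a group of exponent two with at least `k`
elements. The extra nodes are indexed by `X`. In a gadget the in-node `h` is joined with the
out-nodes `h + shift i`, `i < k`, except that the edge from `0` to `0`, which belongs to the index
`base`, is left out. So the two nodes `0` of a gadget have degree `k - 1`; they are the ports of the
gadget, and all other nodes have degree `k`. -/
structure Layout (n k : ℕ) (Γ X H : Type*) [AddCommGroup H] where
  emb : (Γ × H) ⊕ X ↪ Fin n
  shift : Fin k ↪ H
  base : Fin k
  shift_base : shift base = 0
  add_self : ∀ h : H, h + h = 0

namespace Layout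

variable {Γ X H : Type*} [AddCommGroup H] (L : Layout n k Γ X H)

/-- The edge of index `i` at the in-node `h` of the gadget `g`. -/
def inner (g : Γ) (h : H) (i : Fin k) : Edge n :=
  (L.emb (.inl (g, h)), L.emb (.inl (g, h + L.shift i)))

/-- The place of the port of a gadget, or of an extra node. -/
def port : Γ ⊕ X → Fin n
  | .inl g => L.emb (.inl (g, 0))
  | .inr x => L.emb (.inr x)

/-- The edge that joins the in-port (or extra in-node) `p` with the out-port (or extra
out-node) `q`. -/
def outer (p q : Γ ⊕ X) : Edge n := (L.port p, L.port q)

/-- The index pairs `(h, i)` of the edges of a gadget. -/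
def Admissible (h : H) (i : Fin k) : Prop := h ≠ 0 ∨ i ≠ L.base

/-- All edges of the gadget `g` are cached. -/
def ContainsGadget (S : Cache n k) (g : Γ) : Prop :=
  ∀ h i, L.Admissible h i → S.Contains (L.inner g h i)

/-- The edges of the gadget `g` use every colour but `c` at either port, and they do not use `c` at
the in-port. -/
structure IsMissing (S : Cache n k) (g : Γ) (c : Fin k) : Prop where
  out_in : ∀ j, j ≠ c → ∃ i, i ≠ L.base ∧ L.inner g 0 i ∈ S.matching j
  out_out : ∀ j, j ≠ c → ∃ i, i ≠ L.base ∧ L.inner g (L.shift i) i ∈ S.matching j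
  notMem : ∀ i, i ≠ L.base → L.inner g 0 i ∉ S.matching c

variable {L}

theorem port_injective : Function.Injective L.port := by
  rintro (g | x) (g' | x') h <;> simpa [port] using L.emb.injective h

theorem shift_eq_zero {i : Fin k} : L.shift i = 0 ↔ i = L.base := by
  rw [← L.shift_base, L.shift.injective.eq_iff]

theorem add_add_cancel_self (L : Layout n k Γ X H) (a b : H) : a + b + b = a := by
  rw [add_assoc, L.add_self, add_zero]

theorem inner_fst_inj {g g' : Γ} {h h' : H} {i i' : Fin k}
    (e : (L.inner g h i).1 = (L.inner g' h' i').1) : g = g' ∧ h = h' := by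
  simpa [inner] using e

theorem inner_snd_inj {g g' : Γ} {h h' : H} {i i' : Fin k}
    (e : (L.inner g h i).2 = (L.inner g' h' i').2) : g = g' ∧ h + L.shift i = h' + L.shift i' := by
  simpa [inner] using e

theorem inner_inj {g g' : Γ} {h h' : H} {i i' : Fin k}
    (e : L.inner g h i = L.inner g' h' i') : g = g' ∧ h = h' ∧ i = i' := by
  obtain ⟨rfl, rfl⟩ := inner_fst_inj (congrArg Prod.fst e)
  exact ⟨rfl, rfl, by simpa using (inner_snd_inj (congrArg Prod.snd e)).2⟩

/-- A cached gadget misses the same colour at its two ports: every colour is used once at each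
in-node other than the port, and as often at the out-nodes as at the in-nodes. -/
theorem ContainsGadget.exists_isMissing [Fintype H] {S : Cache n k} {g : Γ}
    (hS : L.ContainsGadget S g) : ∃ c, L.IsMissing S g c := by
  classical
  choose! χ hχ using hS
  have hrow : ∀ h i i', L.Admissible h i → L.Admissible h i' → χ h i = χ h i' → i = i' := by
    intro h i i' hi hi' e
    have h1 := hχ h i hi
    have h2 := hχ h i' hi'
    rw [e] at h1
    exact (inner_inj ((S.isMatching _).1 h1 h2 rfl)).2.2
  have hcol : ∀ h i i', L.Admissible (h + L.shift i) i → L.Admissible (h + L.shift i') i' →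
      χ (h + L.shift i) i = χ (h + L.shift i') i' → i = i' := by
    intro h i i' hi hi' e
    have h1 := hχ _ i hi
    have h2 := hχ _ i' hi'
    rw [e] at h1
    refine (inner_inj ((S.isMatching _).2 h1 h2 ?_)).2.2
    simp only [inner, L.add_add_cancel_self]
  -- the colour missing at the in-port
  obtain ⟨c, hc⟩ : ∃ c, ∀ i, i ≠ L.base → χ 0 i ≠ c := by
    by_contra! hcon
    have hlt : ((Finset.univ.erase L.base).image (χ 0)).card < Fintype.card (Fin k) := by
      refine Finset.card_image_le.trans_lt ?_
      rw [← Finset.card_univ]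
      exact Finset.card_lt_card (Finset.erase_ssubset (Finset.mem_univ _))
    refine hlt.ne ?_
    rw [← Finset.card_univ]
    congr 1
    ext j
    obtain ⟨i, hi, hij⟩ := hcon j
    simp only [Finset.mem_image, Finset.mem_erase, Finset.mem_univ, and_true, iff_true]
    exact ⟨i, hi, hij⟩
  -- colouring the absent edge by `c` makes all rows bijective
  let ψ : H → Fin k → Fin k := fun h i => if h = 0 ∧ i = L.base then c else χ h i
  have hψ : ∀ h i, L.Admissible h i → ψ h i = χ h i := by
    intro h i hi
    simp only [Admissible] at hi
    simp only [ψ]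
    rw [if_neg (by tauto)]
  have hψ0 : ψ 0 L.base = c := by simp [ψ]
  have hadm : ∀ h i, ¬ L.Admissible h i → h = 0 ∧ i = L.base := by
    intro h i hi
    simpa [Admissible] using hi
  have hψrow : ∀ h, Function.Bijective (ψ h) := by
    intro h
    refine Finite.injective_iff_bijective.1 fun i i' e => ?_
    by_cases hi : L.Admissible h i <;> by_cases hi' : L.Admissible h i'
    · rw [hψ h i hi, hψ h i' hi'] at e
      exact hrow h i i' hi hi' e
    · obtain ⟨rfl, rfl⟩ := hadm _ _ hi'
      rw [hψ 0 i hi, hψ0] at e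
      exact absurd e (hc i (by simpa [Admissible] using hi))
    · obtain ⟨rfl, rfl⟩ := hadm _ _ hi
      rw [hψ 0 i' hi', hψ0] at e
      exact absurd e.symm (hc i' (by simpa [Admissible] using hi'))
    · exact (hadm _ _ hi).2.trans (hadm _ _ hi').2.symm
  have hψcol : ∀ h', h' ≠ 0 → Function.Bijective fun i => ψ (h' + L.shift i) i := by
    intro h' hh
    have ha : ∀ i, L.Admissible (h' + L.shift i) i := by
      intro i
      by_contra hi
      obtain ⟨h1, rfl⟩ := hadm _ _ hi
      rw [L.shift_base, add_zero] at h1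
      exact hh h1
    refine Finite.injective_iff_bijective.1 fun i i' e => ?_
    simp only [hψ _ _ (ha _)] at e
    exact hcol h' i i' (ha i) (ha i') e
  -- counting the edges of colour `j` by rows and by columns
  have hcount : ∀ j, ∃ i, ψ (L.shift i) i = j := by
    intro j
    by_contra! hj
    have hbij1 : ∀ h, (Finset.univ.filter fun i => ψ h i = j).card = 1 := by
      intro h
      obtain ⟨i, hi⟩ := (hψrow h).2 j
      refine Finset.card_eq_one.2 ⟨i, ?_⟩
      ext i'
      simp only [Finset.mem_filter, Finset.mem_univ, true_and, Finset.mem_singleton]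
      exact ⟨fun e => (hψrow h).1 (e.trans hi.symm), fun e => e ▸ hi⟩
    have hle : ∀ h', (Finset.univ.filter fun i => ψ (h' + L.shift i) i = j).card ≤
        if h' = 0 then 0 else 1 := by
      intro h'
      split_ifs with h0
      · subst h0
        simpa [Finset.filter_eq_empty_iff] using hj
      · refine Finset.card_le_one.2 fun a ha b hb => (hψcol h' h0).1 ?_
        rw [Finset.mem_filter] at ha hb
        exact ha.2.trans hb.2.symm
    have e1 : ∑ h, (Finset.univ.filter fun i => ψ h i = j).card = Fintype.card H := by
      simp [hbij1]
    have e2 : ∑ h, (Finset.univ.filter fun i => ψ h i = j).card =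
        ∑ h', (Finset.univ.filter fun i => ψ (h' + L.shift i) i = j).card := by
      simp only [Finset.card_filter]
      rw [Finset.sum_comm, Finset.sum_comm (γ := H)]
      refine Finset.sum_congr rfl fun i _ => ?_
      exact (Fintype.sum_equiv (Equiv.addRight (L.shift i)) _ _ fun h => rfl).symm
    have e3 : ∑ h' : H, (if h' = 0 then 0 else 1) < Fintype.card H := by
      rw [← Finset.card_univ, Finset.card_eq_sum_ones]
      refine Finset.sum_lt_sum (fun h _ => by split_ifs <;> simp) ⟨0, Finset.mem_univ _, by simp⟩
    have e4 := Finset.sum_le_sum fun h' (_ : h' ∈ Finset.univ) => hle h'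
    omega
  refine ⟨c, ⟨fun j hj => ?_, fun j hj => ?_, fun i hi hmem => ?_⟩⟩
  · obtain ⟨i, hi⟩ := (hψrow 0).2 j
    have hib : i ≠ L.base := by
      rintro rfl
      exact hj (hi.symm.trans hψ0)
    have ha : L.Admissible 0 i := Or.inr hib
    refine ⟨i, hib, ?_⟩
    rw [← hi, hψ 0 i ha]
    exact hχ 0 i ha
  · obtain ⟨i, hi⟩ := hcount j
    have hib : i ≠ L.base := by
      rintro rfl
      rw [L.shift_base] at hi
      exact hj (hi.symm.trans hψ0)
    have ha : L.Admissible (L.shift i) i := Or.inr hib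
    refine ⟨i, hib, ?_⟩
    rw [← hi, hψ _ i ha]
    exact hχ _ i ha
  · -- the other end of the edge has all colours on its own edges, so the edge has no second colour
    have hs : L.shift i ≠ 0 := fun h => hi (shift_eq_zero.1 h)
    obtain ⟨i', hi'⟩ := (hψcol _ hs).2 c
    have ha : L.Admissible (L.shift i + L.shift i') i' := by
      by_contra hna
      obtain ⟨h1, rfl⟩ := hadm _ _ hna
      rw [L.shift_base, add_zero] at h1
      exact hs h1
    simp only [hψ _ _ ha] at hi'
    have hm := hχ _ _ ha
    rw [hi'] at hm
    have := inner_inj ((S.isMatching c).2 hmem hm (by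
      simp only [inner, L.add_add_cancel_self, zero_add]))
    obtain ⟨-, h0, rfl⟩ := this
    rw [← h0] at hi'
    exact hc i hi hi'

/-- An edge at the in-port of a gadget has the missing colour. -/
theorem IsMissing.eq_of_outer_in {S : Cache n k} {g : Γ} {c j : Fin k} (h : L.IsMissing S g c)
    {q : Γ ⊕ X} (hq : L.outer (.inl g) q ∈ S.matching j) : j = c := by
  by_contra hj
  obtain ⟨i, hi, hm⟩ := h.out_in j hj
  have e := congrArg Prod.snd ((S.isMatching j).1 hq hm rfl)
  refine hi (shift_eq_zero.1 ?_)
  rcases q with g' | x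
  · have := L.emb.injective e
    simp only [Sum.inl.injEq, Prod.mk.injEq, zero_add] at this
    exact this.2.symm
  · have := L.emb.injective e
    simp at this

/-- An edge at the out-port of a gadget has the missing colour. -/
theorem IsMissing.eq_of_outer_out {S : Cache n k} {g : Γ} {c j : Fin k} (h : L.IsMissing S g c)
    {p : Γ ⊕ X} (hp : L.outer p (.inl g) ∈ S.matching j) : j = c := by
  by_contra hj
  obtain ⟨i, hi, hm⟩ := h.out_out j hj
  have e := congrArg Prod.fst ((S.isMatching j).2 hp hm (by
    simp only [outer, port, inner, L.add_self]))
  refine hi (shift_eq_zero.1 ?_)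
  rcases p with g' | x
  · have := L.emb.injective e
    simp only [Sum.inl.injEq, Prod.mk.injEq] at this
    exact this.2.symm
  · have := L.emb.injective e
    simp at this

variable (L) in
open Classical in
/-- The colour missing at the ports of the gadget `g` (`base` if there is none). -/
noncomputable def color (S : Cache n k) (g : Γ) : Fin k :=
  if h : ∃ c, L.IsMissing S g c then h.choose else L.base

theorem ContainsGadget.isMissing_color [Fintype H] {S : Cache n k} {g : Γ}
    (hS : L.ContainsGadget S g) : L.IsMissing S g (L.color S g) := by
  have h := hS.exists_isMissing
  rw [color, dif_pos h]
  exact h.choose_spec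

variable [Fintype H] {S T : Cache n k}

/-- A connector transmits the colour from gadget to gadget. -/
theorem color_eq_of_connector {g g' : Γ} (hg : L.ContainsGadget S g)
    (hg' : L.ContainsGadget S g') (h : S.Contains (L.outer (.inl g') (.inl g))) :
    L.color S g = L.color S g' := by
  obtain ⟨j, hj⟩ := h
  rw [← hg.isMissing_color.eq_of_outer_out hj, ← hg'.isMissing_color.eq_of_outer_in hj]

/-- Gadgets whose out-ports are joined to a common in-node have different colours. -/
theorem eq_of_color_eq_of_star_in {g g' : Γ} {p : Γ ⊕ X} (hg : L.ContainsGadget S g)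
    (hg' : L.ContainsGadget S g') (h : S.Contains (L.outer p (.inl g)))
    (h' : S.Contains (L.outer p (.inl g'))) (hc : L.color S g = L.color S g') : g = g' := by
  obtain ⟨j, hj⟩ := h
  obtain ⟨j', hj'⟩ := h'
  have e := hg.isMissing_color.eq_of_outer_out hj
  have e' := hg'.isMissing_color.eq_of_outer_out hj'
  rw [e, hc, ← e'] at hj
  have e2 : L.port (.inl g) = L.port (.inl g') := congrArg Prod.snd ((S.isMatching j').1 hj hj' rfl)
  exact Sum.inl_injective (port_injective e2)

/-- Gadgets whose in-ports are joined to a common out-node have different colours. -/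
theorem eq_of_color_eq_of_star_out {g g' : Γ} {q : Γ ⊕ X} (hg : L.ContainsGadget S g)
    (hg' : L.ContainsGadget S g') (h : S.Contains (L.outer (.inl g) q))
    (h' : S.Contains (L.outer (.inl g') q)) (hc : L.color S g = L.color S g') : g = g' := by
  obtain ⟨j, hj⟩ := h
  obtain ⟨j', hj'⟩ := h'
  have e := hg.isMissing_color.eq_of_outer_in hj
  have e' := hg'.isMissing_color.eq_of_outer_in hj'
  rw [e, hc, ← e'] at hj
  have e2 : L.port (.inl g) = L.port (.inl g') := congrArg Prod.fst ((S.isMatching j').2 hj hj' rfl)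
  exact Sum.inl_injective (port_injective e2)

/-- Each change of the colour of a gadget costs at least one insertion. -/
theorem card_le_switchCost_of_color_ne (D : Finset Γ) (hS : ∀ g ∈ D, L.ContainsGadget S g)
    (hT : ∀ g ∈ D, L.ContainsGadget T g) (h : ∀ g ∈ D, L.color S g ≠ L.color T g) :
    D.card ≤ S.switchCost T := by
  have hex : ∀ g, g ∈ D → ∃ i, i ≠ L.base ∧ L.inner g 0 i ∈ T.matching (L.color S g) :=
    fun g hg => (hT g hg).isMissing_color.out_in _ (h g hg)
  have : Nonempty (Fin k) := ⟨L.base⟩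
  choose! i hib hi using hex
  refine Cache.card_le_switchCost D (fun g => L.color S g) (fun g => L.inner g 0 (i g)) hi
    (fun g hg => (hS g hg).isMissing_color.notMem _ (hib g hg)) ?_
  intro a _ b _ hab
  exact (inner_inj hab).1

end Layout

namespace Layout

variable {Γ X H : Type*} [AddCommGroup H] (L : Layout n k Γ X H)

/-! ### Offline configurations with prescribed gadget colours -/

/-- A proper colouring of edges outside of the gadgets, compatible with the gadget colours `col`:
`R i p q` says that the edge from `p` to `q` is in the matching number `i`. -/
structure IsProper (col : Γ → Fin k) (R : Fin k → Γ ⊕ X → Γ ⊕ X → Prop) : Prop where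
  col_in : ∀ {i g q}, R i (.inl g) q → i = col g
  col_out : ∀ {i g p}, R i p (.inl g) → i = col g
  right_unique : ∀ {i p q q'}, R i p q → R i p q' → q = q'
  left_unique : ∀ {i p p' q}, R i p q → R i p' q → p = p'

open Classical in
/-- The correspondence between indices and colours at the in-node `h` of a gadget of colour `c`: on
the four-cycle through `0` of the edges with indices `base` and `c` these two are interchanged. It
is an involution, and makes `c` the colour of the absent edge. -/
noncomputable def twist (c : Fin k) (h : H) (i : Fin k) : Fin k :=
  if h = 0 ∨ h = L.shift c then Equiv.swap L.base c i else i

theorem twist_twist (c : Fin k) (h : H) (i : Fin k) : L.twist c h (L.twist c h i) = i := by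
  unfold twist
  split_ifs <;> simp

theorem twist_zero_self (c : Fin k) : L.twist c 0 c = L.base := by
  simp [twist]

/-- The edge `e` of a gadget has the colour `i`, where the gadgets have the colours `col`. -/
def InnerColored (col : Γ → Fin k) (i : Fin k) (e : Edge n) : Prop :=
  ∃ g h, L.Admissible h (L.twist (col g) h i) ∧ e = L.inner g h (L.twist (col g) h i)

/-- The edge `e` outside of the gadgets has the colour `i` according to `R`. -/
def OuterColored (R : Fin k → Γ ⊕ X → Γ ⊕ X → Prop) (i : Fin k) (e : Edge n) : Prop :=
  ∃ p q, R i p q ∧ e = L.outer p q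

theorem twist_row_eq {c i : Fin k} {h h' : H}
    (e : h + L.shift (L.twist c h i) = h' + L.shift (L.twist c h' i)) : h = h' := by
  classical
  -- the four-cycle is closed under the edges of the colours `base` and `c`
  have key : ∀ h h' : H, (h = 0 ∨ h = L.shift c) → ¬ (h' = 0 ∨ h' = L.shift c) →
      h + L.shift (L.twist c h i) = h' + L.shift (L.twist c h' i) → h = h' := by
    intro h h' hh hh' e
    rw [twist, twist, if_pos hh, if_neg hh'] at e
    by_cases hb : i = L.base
    · subst hb
      rw [Equiv.swap_apply_left, L.shift_base, add_zero] at e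
      refine absurd ?_ hh'
      rw [← e]
      rcases hh with rfl | rfl
      · right; rw [zero_add]
      · left; exact L.add_self _
    · by_cases hc : i = c
      · subst hc
        rw [Equiv.swap_apply_right, L.shift_base, add_zero] at e
        refine absurd ?_ hh'
        have e' : h' = h + L.shift i := by rw [e, L.add_add_cancel_self]
        rw [e']
        rcases hh with rfl | rfl
        · right; rw [zero_add]
        · left; exact L.add_self _
      · rw [Equiv.swap_apply_of_ne_of_ne hb hc] at e
        exact add_right_cancel e
  by_cases hh : h = 0 ∨ h = L.shift c <;> by_cases hh' : h' = 0 ∨ h' = L.shift c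
  · rw [twist, twist, if_pos hh, if_pos hh'] at e
    exact add_right_cancel e
  · exact key h h' hh hh' e
  · exact (key h' h hh' hh e.symm).symm
  · rw [twist, twist, if_neg hh, if_neg hh'] at e
    exact add_right_cancel e

theorem twist_ne_zero {c : Fin k} {h : H} (ha : L.Admissible h (L.twist c h c)) :
    h + L.shift (L.twist c h c) ≠ 0 := by
  intro e
  have e0 : (0 : H) + L.shift (L.twist c 0 c) = 0 := by
    rw [twist_zero_self, L.shift_base, add_zero]
  have := L.twist_row_eq (e.trans e0.symm)
  subst this
  rw [twist_zero_self] at ha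
  simp [Admissible] at ha

variable {L} in
open Classical in
/-- The configuration in which all gadgets are cached, with the missing colours `col`, and the
edges outside of the gadgets are cached according to `R`. -/
noncomputable def conf {col : Γ → Fin k} {R : Fin k → Γ ⊕ X → Γ ⊕ X → Prop}
    (hR : IsProper col R) : Cache n k where
  matching i := Finset.univ.filter fun e => L.InnerColored col i e ∨ L.OuterColored R i e
  isMatching i := by
    constructor
    · intro e he e' he' hee
      simp only [Finset.coe_filter, Finset.mem_univ, true_and, Set.mem_ofPred_eq] at he he'
      have key : ∀ g h p q, L.Admissible h (L.twist (col g) h i) → R i p q →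
          (L.inner g h (L.twist (col g) h i)).1 = (L.outer p q).1 → False := by
        intro g h p q ha hr hee
        rcases p with g' | x
        · have h2 := L.emb.injective hee
          simp only [Sum.inl.injEq, Prod.mk.injEq] at h2
          obtain ⟨rfl, rfl⟩ := h2
          obtain rfl := hR.col_in hr
          rw [twist_zero_self] at ha
          simp [Admissible] at ha
        · have h2 := L.emb.injective hee
          simp at h2
      rcases he with ⟨g, h, ha, rfl⟩ | ⟨p, q, hr, rfl⟩ <;>
        rcases he' with ⟨g', h', ha', rfl⟩ | ⟨p', q', hr', rfl⟩
      · obtain ⟨rfl, rfl⟩ := inner_fst_inj hee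
        rfl
      · exact (key _ _ _ _ ha hr' hee).elim
      · exact (key _ _ _ _ ha' hr hee.symm).elim
      · obtain rfl := port_injective (L := L) (a₁ := p) (a₂ := p') hee
        rw [hR.right_unique hr hr']
    · intro e he e' he' hee
      simp only [Finset.coe_filter, Finset.mem_univ, true_and, Set.mem_ofPred_eq] at he he'
      have key : ∀ g h p q, L.Admissible h (L.twist (col g) h i) → R i p q →
          (L.inner g h (L.twist (col g) h i)).2 = (L.outer p q).2 → False := by
        intro g h p q ha hr hee
        rcases q with g' | x
        · have h2 := L.emb.injective hee
          simp only [Sum.inl.injEq, Prod.mk.injEq] at h2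
          obtain ⟨rfl, h2⟩ := h2
          obtain rfl := hR.col_out hr
          exact L.twist_ne_zero ha h2
        · have h2 := L.emb.injective hee
          simp at h2
      rcases he with ⟨g, h, ha, rfl⟩ | ⟨p, q, hr, rfl⟩ <;>
        rcases he' with ⟨g', h', ha', rfl⟩ | ⟨p', q', hr', rfl⟩
      · obtain ⟨rfl, e⟩ := inner_snd_inj hee
        rw [L.twist_row_eq e]
      · exact (key _ _ _ _ ha hr' hee).elim
      · exact (key _ _ _ _ ha' hr hee.symm).elim
      · obtain rfl := port_injective (L := L) (a₁ := q) (a₂ := q') hee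
        rw [hR.left_unique hr hr']

section conf

variable {L} {col col' : Γ → Fin k} {R R' : Fin k → Γ ⊕ X → Γ ⊕ X → Prop}

theorem mem_conf (hR : IsProper col R) {i : Fin k} {e : Edge n} :
    e ∈ (L.conf hR).matching i ↔ L.InnerColored col i e ∨ L.OuterColored R i e := by
  simp [conf]

theorem conf_containsGadget (hR : IsProper col R) (g : Γ) : L.ContainsGadget (L.conf hR) g := by
  intro h i hi
  refine ⟨L.twist (col g) h i, (mem_conf hR).2 (Or.inl ⟨g, h, ?_, ?_⟩)⟩
  · rwa [twist_twist]
  · rw [twist_twist]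

theorem conf_contains (hR : IsProper col R) {i : Fin k} {p q : Γ ⊕ X} (h : R i p q) :
    (L.conf hR).Contains (L.outer p q) :=
  ⟨i, (mem_conf hR).2 (Or.inr ⟨p, q, h, rfl⟩)⟩

/-- Recolouring a gadget takes at most `9` insertions, as the two colourings differ in at most
three colours at three in-nodes. The new edges outside of the gadgets are counted by the gadgets
whose port they use. -/
theorem switchCost_conf_le [Fintype Γ] (hR : IsProper col R) (hR' : IsProper col' R')
    (C A B : Finset Γ) (hC : ∀ g, col g ≠ col' g → g ∈ C)
    (hAB : ∀ i p q, R' i p q → ¬ R i p q →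
      (∃ g ∈ A, p = .inl g) ∨ (∃ g ∈ B, q = .inl g)) :
    (L.conf hR).switchCost (L.conf hR') ≤ 9 * C.card + A.card + B.card := by
  classical
  let DC : Γ → Finset (Fin k × Edge n) := fun g =>
    (({0, L.shift (col g), L.shift (col' g)} : Finset H) ×ˢ
      ({L.base, col g, col' g} : Finset (Fin k))).image
      fun x => (x.2, L.inner g x.1 (L.twist (col' g) x.1 x.2))
  let DA : Γ → Finset (Fin k × Edge n) := fun g =>
    Finset.univ.filter fun x => ∃ q, R' x.1 (.inl g) q ∧ x.2 = L.outer (.inl g) q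
  let DB : Γ → Finset (Fin k × Edge n) := fun g =>
    Finset.univ.filter fun x => ∃ p, R' x.1 p (.inl g) ∧ x.2 = L.outer p (.inl g)
  have hDC : ∀ g ∈ C, (DC g).card ≤ 9 := fun g _ => by
    refine Finset.card_image_le.trans ?_
    rw [Finset.card_product]
    exact Nat.mul_le_mul Finset.card_le_three Finset.card_le_three
  have hDA : ∀ g ∈ A, (DA g).card ≤ 1 := fun g _ => by
    refine Finset.card_le_one.2 ?_
    rintro ⟨i, e⟩ h ⟨j, f⟩ h'
    simp only [DA, Finset.mem_filter, Finset.mem_univ, true_and] at h h'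
    obtain ⟨q, hq, rfl⟩ := h
    obtain ⟨q', hq', rfl⟩ := h'
    obtain rfl := hR'.col_in hq
    obtain rfl := hR'.col_in hq'
    rw [hR'.right_unique hq hq']
  have hDB : ∀ g ∈ B, (DB g).card ≤ 1 := fun g _ => by
    refine Finset.card_le_one.2 ?_
    rintro ⟨i, e⟩ h ⟨j, f⟩ h'
    simp only [DB, Finset.mem_filter, Finset.mem_univ, true_and] at h h'
    obtain ⟨q, hq, rfl⟩ := h
    obtain ⟨q', hq', rfl⟩ := h'
    obtain rfl := hR'.col_out hq
    obtain rfl := hR'.col_out hq'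
    rw [hR'.left_unique hq hq']
  have hcard : (C.biUnion DC ∪ A.biUnion DA ∪ B.biUnion DB).card ≤
      9 * C.card + A.card + B.card := by
    have h1 := Finset.card_biUnion_le_card_mul C DC 9 hDC
    have h2 := Finset.card_biUnion_le_card_mul A DA 1 hDA
    have h3 := Finset.card_biUnion_le_card_mul B DB 1 hDB
    have h4 := Finset.card_union_le (C.biUnion DC ∪ A.biUnion DA) (B.biUnion DB)
    have h5 := Finset.card_union_le (C.biUnion DC) (A.biUnion DA)
    omega
  refine (Cache.switchCost_le_card _ fun i e he' he => ?_).trans hcard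
  rw [mem_conf] at he' he
  rw [Finset.mem_union, Finset.mem_union, Finset.mem_biUnion, Finset.mem_biUnion,
    Finset.mem_biUnion]
  rcases he' with ⟨g, h, ha, rfl⟩ | ⟨p, q, hr, rfl⟩
  · -- where the two twists agree, the edge keeps its colour
    have hne : L.twist (col' g) h i ≠ L.twist (col g) h i := by
      intro heq
      exact he (Or.inl ⟨g, h, by rwa [← heq], by rw [heq]⟩)
    left; left
    refine ⟨g, hC g fun hgg => hne (by rw [hgg]), ?_⟩
    simp only [DC, Finset.mem_image, Finset.mem_product, Finset.mem_insert, Finset.mem_singleton]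
    refine ⟨(h, i), ⟨?_, ?_⟩, rfl⟩
    · by_contra hh
      simp only [not_or] at hh
      refine hne ?_
      rw [twist, twist, if_neg (by tauto), if_neg (by tauto)]
    · by_contra hh
      simp only [not_or] at hh
      refine hne ?_
      rw [twist, twist, Equiv.swap_apply_of_ne_of_ne hh.1 hh.2.1,
        Equiv.swap_apply_of_ne_of_ne hh.1 hh.2.2, ite_self, ite_self]
  · rcases hAB i p q hr (fun h => he (Or.inr ⟨p, q, h, rfl⟩)) with ⟨g, hg, rfl⟩ | ⟨g, hg, rfl⟩
    · left; right
      exact ⟨g, hg, by simp only [DA, Finset.mem_filter, Finset.mem_univ, true_and]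
                       exact ⟨q, hr, rfl⟩⟩
    · right
      exact ⟨g, hg, by simp only [DB, Finset.mem_filter, Finset.mem_univ, true_and]
                       exact ⟨p, hr, rfl⟩⟩

end conf

end Layout

/-! ### Paging at a single node -/

theorem sum_count_le_length {α β : Type*} [BEq α] [LawfulBEq α] [Fintype β] {f : β → α}
    (hf : Function.Injective f) (l : List α) : ∑ b, l.count (f b) ≤ l.length := by
  classical
  induction l with
  | nil => simp
  | cons a l ih =>
    have h1 : ∑ b, (if (a == f b) = true then 1 else 0) ≤ 1 := by
      rw [← Finset.card_filter]
      refine Finset.card_le_one.2 fun x hx y hy => hf ?_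
      simp only [beq_iff_eq, Finset.mem_filter, Finset.mem_univ, true_and] at hx hy
      exact hx.symm.trans hy
    simp only [List.count_cons, Finset.sum_add_distrib, List.length_cons]
    omega

/-- The pages of the paging problem at the in-node `u`: the edges to `k + 1` out-nodes. -/
def page (u : Fin n) (v : Option (Fin k) ↪ Fin n) (j : Option (Fin k)) : Edge n := (u, v j)

/-- The configuration that consists of all pages but `j`. -/
def pageConf (u : Fin n) (v : Option (Fin k) ↪ Fin n) (j : Option (Fin k)) : Cache n k where
  matching i := {page u v (if j = some i then none else some i)}
  isMatching i := by simp [IsMatching]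

section paging

variable {u : Fin n} {v : Option (Fin k) ↪ Fin n}

theorem page_injective : Function.Injective (page u v) := fun i j h => by
  simpa [page] using h

theorem pageConf_contains {j j' : Option (Fin k)} (h : j' ≠ j) :
    (pageConf u v j).Contains (page u v j') := by
  rcases j' with _ | i
  · obtain ⟨i, rfl⟩ := Option.ne_none_iff_exists'.1 h.symm
    exact ⟨i, by simp [pageConf]⟩
  · exact ⟨i, by simp [pageConf, h.symm]⟩

theorem switchCost_pageConf_le (j j' : Option (Fin k)) :
    (pageConf u v j).switchCost (pageConf u v j') ≤ 2 := by
  classical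
  refine (Cache.switchCost_le_card ((Finset.eraseNone {j, j'}).image fun i =>
    (i, page u v (if j' = some i then none else some i))) ?_).trans
    (Finset.card_image_le.trans ((Finset.card_eraseNone_le _).trans Finset.card_le_two))
  intro i e he' he
  simp only [pageConf, Finset.mem_singleton] at he' he
  subst he'
  simp only [Finset.mem_image, Finset.mem_eraseNone, Finset.mem_insert, Finset.mem_singleton]
  refine ⟨i, ?_, rfl⟩
  by_contra! h
  exact he (by rw [if_neg h.1.symm, if_neg h.2.symm])

/-- No configuration contains all `k + 1` pages. -/
theorem exists_not_contains_page (u : Fin n) (v : Option (Fin k) ↪ Fin n) (S : Cache n k) :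
    ∃ j, ¬ S.Contains (page u v j) := by
  by_contra! h
  choose χ hχ using h
  have hinj : Function.Injective χ := fun i j hij => by
    have h1 := hχ i
    rw [hij] at h1
    exact page_injective ((S.isMatching _).1 h1 (hχ j) rfl)
  simpa using Fintype.card_le_of_injective χ hinj

theorem DetAlg.exists_page_sequence (A : DetAlg n k) (u : Fin n) (v : Option (Fin k) ↪ Fin n)
    (T : ℕ) : ∃ σ : List (Edge n), σ.length = T ∧ (∀ e ∈ σ, ∃ j, e = page u v j) ∧
      T ≤ A.cost σ := by
  induction T with
  | zero => exact ⟨[], by simp⟩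
  | succ T ih =>
    obtain ⟨σ, h1, h2, h3⟩ := ih
    obtain ⟨j, hj⟩ := exists_not_contains_page u v (A.state σ)
    refine ⟨σ ++ [page u v j], by simp [h1], ?_, ?_⟩
    · intro e he
      rcases List.mem_append.1 he with he | he
      · exact h2 e he
      · exact ⟨j, by simpa using he⟩
    · rw [A.cost_concat]
      have : (A.state σ).switchCost (A.state (σ ++ [page u v j])) ≠ 0 := fun h0 =>
        hj ((A.serves σ _).of_switchCost_eq_zero h0)
      omega

theorem DetAlg.le_of_isCompetitive_paging (hk : 2 ≤ k) (hn : k < n) (A : DetAlg n k) (c : ℝ)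
    (h : A.IsCompetitive c) : ((k : ℝ) + 1) / 3 ≤ c := by
  obtain ⟨d, hd⟩ := h
  have hk0 : (0 : ℝ) < k + 1 := by positivity
  obtain ⟨v⟩ : Nonempty (Option (Fin k) ↪ Fin n) :=
    Function.Embedding.nonempty_of_card_le (by simpa using hn)
  have u : Fin n := ⟨0, by omega⟩
  have key := div_le_of_competitive (X := 1) (Y := 3 / (k + 1)) (D := (k * (n * n) : ℕ)) hd
    one_pos (by positivity) fun m => ?_
  · rwa [one_div_div] at key
  obtain ⟨σ, h1, h2, h3⟩ := A.exists_page_sequence u v m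
  refine ⟨σ, by simpa using h3, ?_⟩
  -- the offline algorithm avoids the page that is requested least often
  have hsum := sum_count_le_length (page_injective (u := u) (v := v)) σ
  obtain ⟨j, -, hj⟩ := Finset.exists_min_image Finset.univ (fun j => σ.count (page u v j))
    Finset.univ_nonempty
  have hmin := Finset.card_nsmul_le_sum Finset.univ _ _ hj
  simp only [Finset.card_univ, Fintype.card_option, Fintype.card_fin, smul_eq_mul] at hmin
  have hopt := (((Serves.nil _).move (pageConf u v j) (Cache.switchCost_le_const _ _)).trans
    (Serves.of_contains_except (by omega) _ (page u v j) σ fun f hf hne => by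
      obtain ⟨j', rfl⟩ := h2 f hf
      exact pageConf_contains fun e => hne (by rw [e]))).optCost_le
  have h4 : (k + 1) * σ.count (page u v j) ≤ m := by omega
  have h5 : (optCost k σ : ℝ) ≤ (k * (n * n) : ℕ) + 3 * (σ.count (page u v j) : ℕ) := by
    have := (Nat.cast_le (α := ℝ)).2 hopt
    simpa only [List.nil_append, zero_add, Nat.cast_add, Nat.cast_mul, Nat.cast_ofNat] using this
  have h6 : ((k : ℝ) + 1) * (σ.count (page u v j) : ℕ) ≤ m := by exact_mod_cast h4
  have h7 : ((σ.count (page u v j) : ℕ) : ℝ) ≤ m / (k + 1) := by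
    rw [le_div_iff₀ hk0]; linarith
  have h8 : (m : ℝ) * (3 / (k + 1)) = 3 * (m / (k + 1)) := by ring
  rw [h8]
  linarith

/-- In a phase, the adversary repeats the pages requested so far until they are all cached; then
a random other page is absent with probability at least one over their number. -/
theorem RandAlg.exists_page_phase (A : RandAlg.{u} n k) (u : Fin n) (v : Option (Fin k) ↪ Fin n)
    (σ : List (Edge n)) (s : ℕ) (hs : s ≤ k) :
    ∃ (M : Finset (Option (Fin k))) (τ : List (Edge n)), M.card = s ∧
      (∀ e ∈ τ, ∃ j ∈ M, e = page u v j) ∧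
      A.expectedCost σ + ∑ r ∈ Finset.range s, 1 / ((k : ℝ) + 1 - r) ≤
        A.expectedCost (σ ++ τ) := by
  classical
  induction s with
  | zero => exact ⟨∅, [], by simp⟩
  | succ s ih =>
    obtain ⟨M, τ, hM, hτ, hc⟩ := ih (by omega)
    have hcard : Fintype.card {q // q ∉ M} = k + 1 - s := by
      rw [Fintype.card_subtype_compl]; simp [hM]
    have : Nonempty {q // q ∉ M} := Fintype.card_pos_iff.1 (by omega)
    let l : List (Edge n) := M.toList.map (page u v)
    obtain ⟨⟨q, hq⟩, hX⟩ := A.exists_continuation (σ ++ τ)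
      (fun q : {q // q ∉ M} => rounds 1 l ++ [page u v q]) (1 / ((k : ℝ) + 1 - s)) (by
      intro D
      have h1 : ((Fintype.card {q // q ∉ M} : ℕ) : ℝ) = (k : ℝ) + 1 - s := by
        rw [hcard, Nat.cast_sub (by omega)]; simp
      have hpos : (0 : ℝ) < (k : ℝ) + 1 - s := by
        have : (s : ℝ) + 1 ≤ k := by exact_mod_cast hs
        linarith
      rw [h1, mul_one_div_cancel hpos.ne']
      have hmono : ∀ q : {q // q ∉ M}, (0 : ℝ) ≤
          (D.cost (σ ++ τ ++ (rounds 1 l ++ [page u v q])) : ℝ) - D.cost (σ ++ τ) := fun q => by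
        rw [sub_nonneg]
        exact_mod_cast D.cost_le_append _ _
      suffices h : ∃ q : {q // q ∉ M}, D.cost (σ ++ τ) + 1 ≤
          D.cost (σ ++ τ ++ (rounds 1 l ++ [page u v q])) by
        obtain ⟨q, hq⟩ := h
        refine le_trans ?_ (Finset.single_le_sum (fun q _ => hmono q) (Finset.mem_univ q))
        rw [le_sub_iff_add_le']
        exact_mod_cast hq
      rcases D.exists_contains_of_rounds l 1 (σ ++ τ) with h | ⟨τ₁, τ₂, he, h⟩
      · refine ⟨Classical.arbitrary _, h.trans ?_⟩
        rw [← List.append_assoc]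
        exact D.cost_le_append _ _
      · obtain ⟨q, hq⟩ := exists_not_contains_page u v (D.state (σ ++ τ ++ τ₁))
        have hqM : q ∉ M := fun hqM => hq (h _ (List.mem_map_of_mem (Finset.mem_toList.2 hqM)))
        refine ⟨⟨q, hqM⟩, ?_⟩
        have e : σ ++ τ ++ (rounds 1 l ++ [page u v q]) =
            (σ ++ τ ++ τ₁) ++ (τ₂ ++ [page u v q]) := by
          rw [he]; simp only [List.append_assoc]
        have hs := D.serves (σ ++ τ ++ τ₁ ++ τ₂) (page u v q)
        have h1 := D.cost_add_switchCost_le (σ ++ τ ++ τ₁) (τ₂ ++ [page u v q])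
        have h2 := D.cost_le_append (σ ++ τ) τ₁
        have h3 : (D.state (σ ++ τ ++ τ₁)).switchCost
            (D.state (σ ++ τ ++ τ₁ ++ (τ₂ ++ [page u v q]))) ≠ 0 := fun h0 =>
          hq (Cache.Contains.of_switchCost_eq_zero h0 (by
            simpa only [List.append_assoc] using hs))
        rw [e]
        omega)
    refine ⟨insert q M, τ ++ (rounds 1 l ++ [page u v q]),
      by rw [Finset.card_insert_of_notMem hq, hM], ?_, ?_⟩
    · intro e he
      simp only [List.mem_append, List.mem_singleton] at he
      rcases he with he | he | he
      · obtain ⟨j, hj, rfl⟩ := hτ e he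
        exact ⟨j, Finset.mem_insert_of_mem hj, rfl⟩
      · obtain ⟨j, hj, rfl⟩ := List.mem_map.1 (mem_of_mem_rounds he)
        exact ⟨j, Finset.mem_insert_of_mem (Finset.mem_toList.1 hj), rfl⟩
      · exact ⟨q, Finset.mem_insert_self _ _, he⟩
    · rw [Finset.sum_range_succ, ← List.append_assoc]
      linarith

theorem sum_reciprocal_ge_log (k : ℕ) (hk : 2 ≤ k) :
    Real.log k / 3 ≤ ∑ r ∈ Finset.range k, 1 / ((k : ℝ) + 1 - r) := by
  have h1 : ∑ r ∈ Finset.range k, 1 / ((k : ℝ) + 1 - r) =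
      ∑ r ∈ Finset.range k, 1 / ((r : ℝ) + 2) := by
    rw [← Finset.sum_range_reflect]
    refine Finset.sum_congr rfl fun r hr => ?_
    have hr := Finset.mem_range.1 hr
    rw [Nat.cast_sub (by omega), Nat.cast_sub (by omega)]
    congr 1
    push_cast
    ring
  have h2 : ((harmonic (k + 1) : ℚ) : ℝ) = 1 + ∑ r ∈ Finset.range k, 1 / ((r : ℝ) + 2) := by
    rw [harmonic, Finset.sum_range_succ']
    push_cast
    rw [add_comm]
    simp only [one_div]
    congr 1
    · simp
    · refine Finset.sum_congr rfl fun r _ => ?_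
      congr 1
      ring
  have h3 := log_add_one_le_harmonic (k + 1)
  have h4 : Real.log k ≤ Real.log (k + 1 + 1 : ℕ) :=
    Real.log_le_log (by exact_mod_cast (by omega : 0 < k)) (by push_cast; linarith)
  have h5 : (1 / 2 : ℝ) ≤ ∑ r ∈ Finset.range k, 1 / ((r : ℝ) + 2) := by
    have := Finset.single_le_sum (f := fun r : ℕ => 1 / ((r : ℝ) + 2)) (s := Finset.range k)
      (fun r _ => by positivity) (Finset.mem_range.2 (by omega : 0 < k))
    simpa using this
  rw [h1]
  linarith

theorem RandAlg.exists_page_sequence (A : RandAlg.{u} n k) (u : Fin n)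
    (v : Option (Fin k) ↪ Fin n) (m : ℕ) :
    ∃ (σ : List (Edge n)) (j : Option (Fin k)),
      m * (∑ r ∈ Finset.range k, 1 / ((k : ℝ) + 1 - r)) ≤ A.expectedCost σ ∧
      Serves (Cache.empty n k) σ (k * (n * n) + 2 * m) (pageConf u v j) := by
  induction m with
  | zero =>
    exact ⟨[], none, by simpa using A.expectedCost_nonneg [],
      Serves.switch (Cache.switchCost_le_const _ _)⟩
  | succ m ih =>
    obtain ⟨σ, j, hc, hS⟩ := ih
    obtain ⟨M, τ, hM, hτ, hc'⟩ := A.exists_page_phase u v σ k le_rfl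
    obtain ⟨j', hj'⟩ : ∃ j', j' ∉ M := by
      by_contra! h
      have := Finset.card_le_card fun x (_ : x ∈ Finset.univ) => h x
      simp [hM] at this
    refine ⟨σ ++ τ, j', by push_cast; linarith, ?_⟩
    refine Serves.mono ((hS.move _ (switchCost_pageConf_le j j')).trans
      (Serves.of_contains τ fun e he => ?_)) (by omega)
    obtain ⟨i, hi, rfl⟩ := hτ e he
    exact pageConf_contains fun h => hj' (h ▸ hi)

theorem RandAlg.le_of_isCompetitive_paging (hk : 2 ≤ k) (hn : k < n) (A : RandAlg.{u} n k) (c : ℝ)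
    (h : A.IsCompetitive c) : Real.log k / 6 ≤ c := by
  obtain ⟨d, hd⟩ := h
  obtain ⟨v⟩ : Nonempty (Option (Fin k) ↪ Fin n) :=
    Function.Embedding.nonempty_of_card_le (by simpa using hn)
  have u : Fin n := ⟨0, by omega⟩
  have hX := sum_reciprocal_ge_log k hk
  have hlog : 0 < Real.log k := Real.log_pos (by exact_mod_cast hk)
  have key := div_le_of_competitive (X := ∑ r ∈ Finset.range k, 1 / ((k : ℝ) + 1 - r)) (Y := 2)
    (D := (k * (n * n) : ℕ)) hd (by linarith) two_pos fun m => by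
      obtain ⟨σ, j, h1, h2⟩ := A.exists_page_sequence u v m
      refine ⟨σ, h1, ?_⟩
      have := (Nat.cast_le (α := ℝ)).2 h2.optCost_le
      rw [Nat.cast_add, Nat.cast_mul 2 m] at this
      push_cast at this ⊢
      linarith
  linarith

end paging

namespace Layout

/-! ### Networks of gadgets -/

theorem exists_layout {Γ X : Type*} [Fintype Γ] [Fintype X] (T : ℕ) (hk : 0 < k) (hkT : k ≤ 2 ^ T)
    (hn : Fintype.card Γ * 2 ^ T + Fintype.card X ≤ n) :
    Nonempty (Layout n k Γ X (Fin T → ZMod 2)) := by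
  obtain ⟨emb⟩ : Nonempty ((Γ × (Fin T → ZMod 2)) ⊕ X ↪ Fin n) :=
    Function.Embedding.nonempty_of_card_le (by simpa [ZMod.card] using hn)
  obtain ⟨s⟩ : Nonempty (Fin k ↪ (Fin T → ZMod 2)) :=
    Function.Embedding.nonempty_of_card_le (by simpa [ZMod.card] using hkT)
  exact ⟨{ emb := emb
           shift := ⟨fun i => s i - s ⟨0, hk⟩, fun i j h => s.injective (sub_left_injective h)⟩
           base := ⟨0, hk⟩
           shift_base := sub_self _
           add_self := fun h => funext fun i => CharTwo.add_self_eq_zero _ }⟩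

variable {Γ X H : Type*} [AddCommGroup H] (L : Layout n k Γ X H)

/-- A list of the edges of the gadgets in `Q` and of the edges between ports that are
related by `F`. -/
noncomputable def network [Fintype Γ] [Fintype X] [Fintype H] (Q : Γ → Prop)
    (F : Γ ⊕ X → Γ ⊕ X → Prop) : List (Edge n) := by
  classical
  exact ((Finset.univ.filter fun x : Γ × H × Fin k => Q x.1 ∧ L.Admissible x.2.1 x.2.2).image
      fun x => L.inner x.1 x.2.1 x.2.2).toList ++
    ((Finset.univ.filter fun x : (Γ ⊕ X) × (Γ ⊕ X) => F x.1 x.2).image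
      fun x => L.outer x.1 x.2).toList

/-- The edges between ports in `R`, each with the colour of the gadgets at its ends. -/
def colorRel (col : Γ → Fin k) (F : Γ ⊕ X → Γ ⊕ X → Prop) (i : Fin k) (p q : Γ ⊕ X) : Prop :=
  F p q ∧ (∀ g, p = .inl g → i = col g) ∧ ∀ g, q = .inl g → i = col g

/-- The edges between ports in `F` can all be cached next to gadgets that have the
colours `col`. -/
structure IsCompatible (col : Γ → Fin k) (F : Γ ⊕ X → Γ ⊕ X → Prop) : Prop where
  connector : ∀ g g', F (.inl g) (.inl g') → col g = col g'
  not_extra : ∀ x y, ¬ F (.inr x) (.inr y)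
  in_unique : ∀ g q q', F (.inl g) q → F (.inl g) q' → q = q'
  out_unique : ∀ g p p', F p (.inl g) → F p' (.inl g) → p = p'
  star_in : ∀ x g g', F (.inr x) (.inl g) → F (.inr x) (.inl g') → col g = col g' → g = g'
  star_out : ∀ x g g', F (.inl g) (.inr x) → F (.inl g') (.inr x) → col g = col g' → g = g'

variable {L} {col : Γ → Fin k} {F : Γ ⊕ X → Γ ⊕ X → Prop}

theorem forall_mem_network [Fintype Γ] [Fintype X] [Fintype H] {Q : Γ → Prop} {S : Cache n k} :
    (∀ e ∈ L.network Q F, S.Contains e) ↔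
      (∀ g, Q g → L.ContainsGadget S g) ∧ ∀ p q, F p q → S.Contains (L.outer p q) := by
  simp only [network, List.mem_append, Finset.mem_toList, Finset.mem_image, Finset.mem_filter,
    Finset.mem_univ, true_and, ContainsGadget]
  constructor
  · intro h
    exact ⟨fun g hg x i hi => h _ (Or.inl ⟨(g, x, i), ⟨hg, hi⟩, rfl⟩),
      fun p q hpq => h _ (Or.inr ⟨(p, q), hpq, rfl⟩)⟩
  · rintro ⟨h1, h2⟩ e (⟨x, ⟨hg, hi⟩, rfl⟩ | ⟨x, hx, rfl⟩)
    · exact h1 _ hg _ _ hi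
    · exact h2 _ _ hx

theorem mem_network_cases [Fintype Γ] [Fintype X] [Fintype H] {Q : Γ → Prop} {e : Edge n}
    (h : e ∈ L.network Q F) :
    (∃ g h i, L.Admissible h i ∧ e = L.inner g h i) ∨ ∃ p q, F p q ∧ e = L.outer p q := by
  simp only [network, List.mem_append, Finset.mem_toList, Finset.mem_image, Finset.mem_filter,
    Finset.mem_univ, true_and] at h
  rcases h with ⟨x, ⟨_, hi⟩, rfl⟩ | ⟨x, hx, rfl⟩
  · exact Or.inl ⟨_, _, _, hi, rfl⟩
  · exact Or.inr ⟨_, _, hx, rfl⟩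

theorem outer_injective {p q p' q' : Γ ⊕ X} (h : L.outer p q = L.outer p' q') :
    p = p' ∧ q = q' :=
  ⟨port_injective (L := L) (congrArg Prod.fst h), port_injective (L := L) (congrArg Prod.snd h)⟩

theorem IsCompatible.isProper (h : IsCompatible col F) : IsProper col (colorRel col F) where
  col_in hR := hR.2.1 _ rfl
  col_out hR := hR.2.2 _ rfl
  right_unique := by
    rintro i (g | x) q q' h1 h2
    · exact h.in_unique g q q' h1.1 h2.1
    · rcases q with g | y
      · rcases q' with g' | y'
        · rw [h.star_in x g g' h1.1 h2.1 ((h1.2.2 g rfl).symm.trans (h2.2.2 g' rfl))]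
        · exact absurd h2.1 (h.not_extra x y')
      · exact absurd h1.1 (h.not_extra x y)
  left_unique := by
    rintro i p p' (g | x) h1 h2
    · exact h.out_unique g p p' h1.1 h2.1
    · rcases p with g | y
      · rcases p' with g' | y'
        · rw [h.star_out x g g' h1.1 h2.1 ((h1.2.1 g rfl).symm.trans (h2.2.1 g' rfl))]
        · exact absurd h2.1 (h.not_extra y' x)
      · exact absurd h1.1 (h.not_extra y x)

theorem IsCompatible.exists_colorRel (h : IsCompatible col F) {p q : Γ ⊕ X} (hpq : F p q) :
    ∃ i, colorRel col F i p q := by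
  rcases p with g | x
  · refine ⟨col g, hpq, fun g' hg => by rw [Sum.inl_injective hg], ?_⟩
    rintro g' rfl
    exact h.connector g g' hpq
  · rcases q with g | y
    · exact ⟨col g, hpq, fun g' hg => by simp at hg, fun g' hg => by rw [Sum.inl_injective hg]⟩
    · exact absurd hpq (h.not_extra x y)

theorem IsCompatible.contains (h : IsCompatible col F) {p q : Γ ⊕ X} (hpq : F p q) :
    (L.conf h.isProper).Contains (L.outer p q) := by
  obtain ⟨i, hi⟩ := h.exists_colorRel hpq
  exact conf_contains h.isProper hi

end Layout

/-! ### A deterministic lower bound from two wires -/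

/-- The adversary requests absent edges of `l`: after `m` requests the algorithm has paid `m`,
unless it holds all of `l` earlier. -/
theorem DetAlg.exists_chase (A : DetAlg n k) (l : List (Edge n)) (m : ℕ) (σ : List (Edge n)) :
    ∃ τ : List (Edge n), τ.length ≤ m ∧ (∀ e ∈ τ, e ∈ l) ∧
      (A.cost σ + m ≤ A.cost (σ ++ τ) ∨ ∀ e ∈ l, (A.state (σ ++ τ)).Contains e) := by
  induction m generalizing σ with
  | zero => exact ⟨[], by simp⟩
  | succ m ih =>
    by_cases h : ∀ e ∈ l, (A.state σ).Contains e
    · exact ⟨[], by simp, by simp, Or.inr (by simpa using h)⟩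
    · push Not at h
      obtain ⟨e, he, hS⟩ := h
      obtain ⟨τ, h1, h2, h3⟩ := ih (σ ++ [e])
      have hc := A.cost_concat σ e
      have h0 : (A.state σ).switchCost (A.state (σ ++ [e])) ≠ 0 := fun h0 =>
        hS ((A.serves σ e).of_switchCost_eq_zero h0)
      simp only [List.append_assoc, List.singleton_append] at h3
      refine ⟨e :: τ, by simpa using h1, ?_, h3.imp (fun h => by omega) id⟩
      intro f hf
      rcases List.mem_cons.1 hf with rfl | hf
      · exact he
      · exact h2 f hf

section twoWires

variable {m : ℕ}

/-- Two wires of `m + 1` gadgets each: the connectors inside the wires, an extra in-node joined to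
the end of the second wire, and the edge at the end of the first wire, which leads either to the
start of the second wire (`b = false`) or to the extra node (`b = true`). In the former case the two
wires have the same colour, in the latter they have different colours. -/
def twoWires (m : ℕ) (b : Bool) :
    (Bool × Fin (m + 1)) ⊕ Unit → (Bool × Fin (m + 1)) ⊕ Unit → Prop
  | .inl (w', z'), .inl (w, z) => (w' = w ∧ z'.val = z.val + 1) ∨
      (b = false ∧ w' = true ∧ w = false ∧ z'.val = 0 ∧ z.val = m)
  | .inr _, .inl (w, z) => z.val = m ∧ (w = true ∨ b = true)
  | _, .inr _ => False

/-- The edges `twoWires`, without the connector of the second wire at `s`. -/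
def brokenWires (b : Bool) (s : Fin m) (p q : (Bool × Fin (m + 1)) ⊕ Unit) : Prop :=
  twoWires m b p q ∧ ¬ (p = .inl (true, s.succ) ∧ q = .inl (true, s.castSucc))

/-- The part of the second wire behind `s` has the colour `c₁`, all the rest has `c₀`. -/
def brokenCol (c₀ c₁ : Fin k) (s : Fin m) (g : Bool × Fin (m + 1)) : Fin k :=
  if g.1 = true ∧ s.val < g.2.val then c₁ else c₀

theorem isCompatible_brokenWires {c₀ c₁ : Fin k} (hc : c₀ ≠ c₁) (b : Bool) (s : Fin m) :
    Layout.IsCompatible (brokenCol c₀ c₁ s) (brokenWires b s) := by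
  have hs := s.2
  constructor
  · rintro ⟨w, z⟩ ⟨w', z'⟩ ⟨h, hne⟩
    simp only [twoWires, Sum.inl.injEq, Prod.mk.injEq, Fin.ext_iff, Fin.val_succ,
      Fin.val_castSucc] at h hne
    simp only [brokenCol]
    grind
  · rintro x y ⟨h, -⟩
    exact h
  · rintro ⟨w, z⟩ (⟨w₁, z₁⟩ | x) (⟨w₂, z₂⟩ | y) ⟨h, -⟩ ⟨h', -⟩ <;>
      simp only [twoWires, Sum.inl.injEq, Prod.mk.injEq, Fin.ext_iff] at h h' ⊢
    grind
  · rintro ⟨w, z⟩ (⟨w₁, z₁⟩ | x) (⟨w₂, z₂⟩ | y) ⟨h, -⟩ ⟨h', -⟩ <;>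
      simp only [twoWires, Sum.inl.injEq, Prod.mk.injEq, Fin.ext_iff] at h h' ⊢ <;>
      grind
  · rintro x ⟨w, z⟩ ⟨w', z'⟩ ⟨h, -⟩ ⟨h', -⟩ he
    simp only [twoWires, Prod.mk.injEq, Fin.ext_iff, brokenCol] at h h' he ⊢
    grind
  · rintro x g g' ⟨h, -⟩
    exact h.elim

variable {H : Type*} [AddCommGroup H] {L : Layout n k (Bool × Fin (m + 1)) Unit H}

/-- The connector of the second wire at `s`. -/
def brokenEdge (L : Layout n k (Bool × Fin (m + 1)) Unit H) (s : Fin m) : Edge n :=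
  L.outer (.inl (true, s.succ)) (.inl (true, s.castSucc))

theorem brokenEdge_injective : Function.Injective (brokenEdge L) := fun s s' h => by
  simpa using (Layout.outer_injective h).1

/-- The offline configuration that does without the connector at `s`. -/
noncomputable def brokenConf (L : Layout n k (Bool × Fin (m + 1)) Unit H) {c₀ c₁ : Fin k}
    (hc : c₀ ≠ c₁) (b : Bool) (s : Fin m) : Cache n k :=
  L.conf (isCompatible_brokenWires hc b s).isProper

theorem switchCost_brokenConf_le {c₀ c₁ : Fin k} (hc : c₀ ≠ c₁) (b b' : Bool) (s : Fin m) :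
    (brokenConf L hc b s).switchCost (brokenConf L hc b' s) ≤ 1 := by
  refine (Layout.switchCost_conf_le _ _ ∅ ∅ {(false, Fin.last m)} (by simp) ?_).trans (by simp)
  rintro i p q ⟨⟨h, hne⟩, hcol⟩ h'
  right
  refine ⟨_, Finset.mem_singleton_self _, ?_⟩
  have h'' : ¬ twoWires m b p q := fun h2 => h' ⟨⟨h2, hne⟩, hcol⟩
  rcases p with ⟨w', z'⟩ | x <;> rcases q with ⟨w, z⟩ | y <;>
    simp only [twoWires, Sum.inl.injEq, Prod.mk.injEq, Fin.ext_iff, Fin.val_last] at h h'' ⊢ <;>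
    grind

variable [Fintype H]

theorem color_eq_of_twoWires {S : Cache n k} {b : Bool}
    (h : ∀ e ∈ L.network (fun _ => True) (twoWires m b), S.Contains e) (w : Bool)
    (z : Fin (m + 1)) : L.color S (w, z) = L.color S (w, 0) := by
  rw [Layout.forall_mem_network] at h
  induction z using Fin.induction with
  | zero => rfl
  | succ z ih =>
    rw [← ih]
    exact (Layout.color_eq_of_connector (h.1 _ trivial) (h.1 _ trivial)
      (h.2 _ _ (by simp [twoWires]))).symm

/-- One of the wires has to be recoloured altogether between the two kinds of phases. -/
theorem le_switchCost_of_twoWires {S T : Cache n k}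
    (hS : ∀ e ∈ L.network (fun _ => True) (twoWires m false), S.Contains e)
    (hT : ∀ e ∈ L.network (fun _ => True) (twoWires m true), T.Contains e) :
    m + 1 ≤ S.switchCost T := by
  have h1 := color_eq_of_twoWires hS
  have h2 := color_eq_of_twoWires hT
  have hS' := Layout.forall_mem_network.1 hS
  have hT' := Layout.forall_mem_network.1 hT
  have e1 : L.color S (true, 0) = L.color S (false, 0) := by
    rw [← h1 false (Fin.last m)]
    exact (Layout.color_eq_of_connector (hS'.1 _ trivial) (hS'.1 _ trivial)
      (hS'.2 _ _ (by simp [twoWires]))).symm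
  have e2 : L.color T (true, 0) ≠ L.color T (false, 0) := by
    intro he
    rw [← h2 false (Fin.last m), ← h2 true (Fin.last m)] at he
    have := Layout.eq_of_color_eq_of_star_in (p := .inr ()) (hT'.1 _ trivial) (hT'.1 _ trivial)
      (hT'.2 _ _ (by simp [twoWires])) (hT'.2 _ _ (by simp [twoWires])) he
    simp at this
  obtain ⟨w, hw⟩ : ∃ w, L.color S (w, 0) ≠ L.color T (w, 0) := by
    by_contra! h
    exact e2 (by rw [← h, ← h, e1])
  have := Layout.card_le_switchCost_of_color_ne (L := L) (S := S) (T := T)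
    (Finset.univ.map ⟨fun z : Fin (m + 1) => (w, z), fun a b h => by simpa using h⟩)
    (fun g _ => hS'.1 g trivial) (fun g _ => hT'.1 g trivial) (by
      intro g hg
      obtain ⟨z, -, rfl⟩ := Finset.mem_map.1 hg
      change L.color S (w, z) ≠ L.color T (w, z)
      rwa [h1 w z, h2 w z])
  simpa using this

theorem brokenConf_contains {c₀ c₁ : Fin k} (hc : c₀ ≠ c₁) (b : Bool) (s : Fin m) {e : Edge n}
    (he : e ∈ L.network (fun _ => True) (twoWires m b)) (hs : e ≠ brokenEdge L s) :
    (brokenConf L hc b s).Contains e := by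
  rcases Layout.mem_network_cases he with ⟨g, h, i, hi, rfl⟩ | ⟨p, q, hF, rfl⟩
  · exact Layout.conf_containsGadget _ g h i hi
  · refine (isCompatible_brokenWires hc b s).contains ⟨hF, ?_⟩
    rintro ⟨rfl, rfl⟩
    exact hs rfl

theorem DetAlg.exists_twoWires_sequence (hk : 0 < k) (A : DetAlg n k)
    (L : Layout n k (Bool × Fin (m + 1)) Unit H) {c₀ c₁ : Fin k} (hc : c₀ ≠ c₁) (M : ℕ) :
    ∃ σ : List (Edge n), σ.length ≤ M * (2 * (m + 1)) ∧ M * (m + 1) ≤ A.cost σ ∧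
      ∀ s : Fin m, Serves (Cache.empty n k) σ
        (k * (n * n) + 2 * M + 3 * σ.count (brokenEdge L s)) (brokenConf L hc true s) := by
  induction M with
  | zero =>
    exact ⟨[], by simp, by simp, fun s => by
      simpa using Serves.switch (Cache.switchCost_le_const _ _)⟩
  | succ M ih =>
    obtain ⟨σ, h1, h2, h3⟩ := ih
    obtain ⟨τ, t1, t2, t3⟩ :=
      A.exists_chase (L.network (fun _ => True) (twoWires m false)) (m + 1) σ
    obtain ⟨τ', t1', t2', t3'⟩ :=
      A.exists_chase (L.network (fun _ => True) (twoWires m true)) (m + 1) (σ ++ τ)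
    have c1 := A.cost_le_append σ τ
    have c2 := A.cost_le_append (σ ++ τ) τ'
    refine ⟨σ ++ τ ++ τ', ?_, ?_, fun s => ?_⟩
    · simp only [List.length_append]
      rw [Nat.succ_mul]
      omega
    · rw [Nat.succ_mul]
      rcases t3 with t3 | t3
      · omega
      · rcases t3' with t3' | t3'
        · omega
        · have := le_switchCost_of_twoWires t3 t3'
          have := A.cost_add_switchCost_le (σ ++ τ) τ'
          omega
    · have a1 := ((h3 s).move (brokenConf L hc false s) (switchCost_brokenConf_le hc _ _ s)).trans
        (Serves.of_contains_except hk _ (brokenEdge L s) τ fun f hf hne =>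
          brokenConf_contains hc false s (t2 f hf) hne)
      have a2 := (a1.move (brokenConf L hc true s) (switchCost_brokenConf_le hc _ _ s)).trans
        (Serves.of_contains_except hk _ (brokenEdge L s) τ' fun f hf hne =>
          brokenConf_contains hc true s (t2' f hf) hne)
      refine a2.mono ?_
      simp only [List.count_append]
      omega

end twoWires

/-- Two wires of `m + 1` gadgets give the lower bound `(m + 1) / 14`. -/
theorem DetAlg.le_of_isCompetitive_twoWires (hk : 2 ≤ k) {m T : ℕ} (hm : 0 < m)
    (hT : k ≤ 2 ^ T) (hn : 2 * (m + 1) * 2 ^ T + 1 ≤ n) (A : DetAlg n k) (c : ℝ)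
    (h : A.IsCompetitive c) : ((m : ℝ) + 1) / 14 ≤ c := by
  obtain ⟨d, hd⟩ := h
  obtain ⟨L⟩ := Layout.exists_layout (n := n) (k := k) (Γ := Bool × Fin (m + 1)) (X := Unit) T
    (by omega) hT (by simpa using hn)
  have hc : (⟨0, by omega⟩ : Fin k) ≠ ⟨1, by omega⟩ := by simp
  refine div_le_of_competitive (X := (m : ℝ) + 1) (Y := 14) (D := (k * (n * n) : ℕ)) hd
    (by positivity) (by norm_num) fun M => ?_
  obtain ⟨σ, h1, h2, h3⟩ := A.exists_twoWires_sequence (by omega) L hc M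
  refine ⟨σ, by exact_mod_cast h2, ?_⟩
  -- the offline algorithm breaks the second wire at the connector requested least often
  have hsum := sum_count_le_length (brokenEdge_injective (L := L)) σ
  have : Nonempty (Fin m) := ⟨⟨0, hm⟩⟩
  obtain ⟨s, -, hs⟩ := Finset.exists_min_image Finset.univ (fun s => σ.count (brokenEdge L s))
    Finset.univ_nonempty
  have hmin := Finset.card_nsmul_le_sum Finset.univ _ _ hs
  simp only [Finset.card_univ, Fintype.card_fin, smul_eq_mul] at hmin
  have h4 : m * σ.count (brokenEdge L s) ≤ m * (4 * M) := by
    have : M * (2 * (m + 1)) ≤ m * (4 * M) := by nlinarith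
    omega
  have h5 := Nat.le_of_mul_le_mul_left h4 hm
  have h6 := (h3 s).optCost_le
  have h7 : optCost k σ ≤ M * 14 + k * (n * n) := by omega
  exact_mod_cast h7

/-! ### Bundles of wires -/

/-- The `2 ^ t + r` wires of a bundle. Two bundles are joined along a permutation that adds a bit
vector to the indices of the first kind and fixes those of the second kind. -/
abbrev Wire (t r : ℕ) : Type := (Fin t → ZMod 2) ⊕ Fin r

namespace Wire

variable {t r : ℕ}

/-- The permutation of the wires given by a bit vector. -/
def act (w : Fin t → ZMod 2) : Wire t r → Wire t r := Sum.map (w + ·) id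

/-- The bit `d` of a wire, shifted by `β`; wires of the second kind have bit `0`. -/
def label (d : Fin t) (β : ZMod 2) : Wire t r → ZMod 2
  | .inl w => w d + β
  | .inr _ => 0

theorem act_act (a b : Fin t → ZMod 2) (i : Wire t r) : act a (act b i) = act (a + b) i := by
  rcases i with i | i <;> simp [act, add_assoc]

theorem act_self (a : Fin t → ZMod 2) (i : Wire t r) : act a (act a i) = i := by
  have h : a + a = 0 := funext fun _ => CharTwo.add_self_eq_zero _
  rw [act_act, h]
  rcases i with i | i <;> simp [act]

theorem act_injective (a : Fin t → ZMod 2) : Function.Injective (act a : Wire t r → Wire t r) :=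
  Function.LeftInverse.injective (act_self a)

theorem label_act (d : Fin t) (β : ZMod 2) (a : Fin t → ZMod 2) (i : Wire t r) :
    label d β (act a i) = label d (β + a d) i := by
  rcases i with i | i
  · simp only [act, label, Sum.map_inl, Pi.add_apply]
    ring
  · rfl

end Wire

open Wire

section bundles

variable {N t r : ℕ}

/-- The gadgets of a bundle of length `N`, and two extra nodes. -/
abbrev BundlePort (N t r : ℕ) : Type := (Fin N × Wire t r) ⊕ ZMod 2

/-- The connectors from the position `z' - 1` to `z'`, for the positions `z'` in `P`. The bit
vectors `V` tell which wires are joined: the wire `i` at the position `z` belongs to the track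
`act (V z) i`. -/
def connEdges (V : ℕ → Fin t → ZMod 2) (P : ℕ → Prop) : BundlePort N t r → BundlePort N t r → Prop
  | .inl (z', j), .inl (z, i) => z'.val = z.val + 1 ∧ P z'.val ∧ act (V z) i = act (V z') j
  | _, _ => False

/-- The stars at the starts of the bundles on `[p, p + l)` and `[p + l, p + 2 * l)`. -/
def starEdges (p l : ℕ) : BundlePort N t r → BundlePort N t r → Prop
  | .inl (z, _), .inr y => (z.val = p ∧ y = 0) ∨ (z.val = p + l ∧ y = 1)
  | _, _ => False

/-- The stars at the ends of the bundles on `[p, p + l)` and `[p + l, p + 2 * l)` that test a bit of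
the relative permutation: the extra node `x` is joined to the wires with bit `x` of the first
bundle and to the wires with shifted bit `x + 1` of the second one. -/
def testEdges (p l : ℕ) (d : Fin t) (β : ZMod 2) : BundlePort N t r → BundlePort N t r → Prop
  | .inr x, .inl (z, i) =>
    (z.val + 1 = p + l ∧ label d 0 i = x) ∨ (z.val + 1 = p + 2 * l ∧ label d β i = x + 1)
  | _, _ => False

/-- The edges outside of the gadgets that are requested to see the bundles on `[p, p + l)` and
`[p + l, p + 2 * l)`. -/
def homeEdges (V : ℕ → Fin t → ZMod 2) (p l : ℕ) (a b : BundlePort N t r) : Prop :=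
  connEdges V (fun z => p < z ∧ z < p + 2 * l ∧ z ≠ p + l) a b ∨ starEdges p l a b

/-- The edges outside of the gadgets that the offline algorithm holds while the bundles on
`[p, p + l)` and `[p + l, p + 2 * l)` are tested. It keeps all connectors but those at the
ends of these bundles. -/
def mergeEdges (V : ℕ → Fin t → ZMod 2) (p l : ℕ) (d : Fin t) (a b : BundlePort N t r) : Prop :=
  connEdges V (fun z => z ≠ p ∧ z ≠ p + l ∧ z ≠ p + 2 * l) a b ∨ starEdges p l a b ∨
    testEdges p l d ((V (p + l - 1) + V (p + 2 * l - 1)) d) a b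

/-- The gadget colours of the offline algorithm: every track has its own colour. -/
def trackCol (e : Wire t r ≃ Fin k) (V : ℕ → Fin t → ZMod 2) (g : Fin N × Wire t r) : Fin k :=
  e (act (V g.1) g.2)

theorem isCompatible_mergeEdges (e : Wire t r ≃ Fin k) (V : ℕ → Fin t → ZMod 2) (p : ℕ) {l : ℕ}
    (hl : 0 < l) (d : Fin t) :
    Layout.IsCompatible (trackCol (N := N) e V) (mergeEdges V p l d) := by
  have h01 : (0 : ZMod 2) ≠ 1 := by decide
  constructor
  · rintro ⟨z, i⟩ ⟨z', j⟩ (h | h | h)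
    · simp only [trackCol, h.2.2]
    · exact h.elim
    · exact h.elim
  · rintro x y (h | h | h) <;> exact h
  · rintro ⟨z, i⟩ (⟨z₁, i₁⟩ | y₁) (⟨z₂, i₂⟩ | y₂) (h | h | h) (h' | h' | h') <;>
      simp only [connEdges, starEdges, testEdges] at h h'
    · obtain rfl : z₁ = z₂ := Fin.ext (by omega)
      rw [act_injective _ (h.2.2.trans h'.2.2.symm)]
    · omega
    · omega
    · have : y₁ = y₂ := by
        rcases h with ⟨h, rfl⟩ | ⟨h, rfl⟩ <;> rcases h' with ⟨h', rfl⟩ | ⟨h', rfl⟩ <;>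
          first | rfl | omega
      rw [this]
  · rintro ⟨z, i⟩ (⟨z₁, i₁⟩ | y₁) (⟨z₂, i₂⟩ | y₂) (h | h | h) (h' | h' | h') <;>
      simp only [connEdges, starEdges, testEdges] at h h'
    · obtain rfl : z₁ = z₂ := Fin.ext (by omega)
      rw [act_injective _ (h.2.2.symm.trans h'.2.2)]
    · omega
    · omega
    · have : y₁ = y₂ := by
        rcases h with ⟨h, h2⟩ | ⟨h, h2⟩ <;> rcases h' with ⟨h', h2'⟩ | ⟨h', h2'⟩
        · exact h2.symm.trans h2'
        · omega
        · omega
        · exact add_right_cancel (h2.symm.trans h2')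
      rw [this]
  · rintro x ⟨z, i⟩ ⟨z', i'⟩ (h | h | h) (h' | h' | h') hc <;>
      simp only [connEdges, starEdges, testEdges] at h h'
    have hc : act (V z) i = act (V z') i' := e.injective hc
    -- the tracks of the two kinds of wires at the node `x` differ in the bit `d`
    have key : ∀ (z z' : Fin N) (i i' : Wire t r), act (V z) i = act (V z') i' →
        z.val + 1 = p + l → label d 0 i = x → z'.val + 1 = p + 2 * l →
        label d ((V (p + l - 1) + V (p + 2 * l - 1)) d) i' = x + 1 → False := by
      intro z z' i i' hc h1 h2 h3 h4
      have e1 : p + l - 1 = z := by omega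
      have e2 : p + 2 * l - 1 = z' := by omega
      have e3 : i = act (V z + V z') i' := by
        rw [← act_act, ← hc, act_self]
      rw [e1, e2] at h4
      rw [e3, label_act, zero_add, h4] at h2
      exact h01 (left_eq_add.1 h2.symm).symm
    rcases h with ⟨h, h2⟩ | ⟨h, h2⟩ <;> rcases h' with ⟨h', h2'⟩ | ⟨h', h2'⟩
    · obtain rfl : z = z' := Fin.ext (by omega)
      rw [act_injective _ hc]
    · exact (key z z' i i' hc h h2 h' h2').elim
    · exact (key z' z i' i hc.symm h' h2' h h2).elim
    · obtain rfl : z = z' := Fin.ext (by omega)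
      rw [act_injective _ hc]
  · rintro y ⟨z, i⟩ ⟨z', i'⟩ (h | h | h) (h' | h' | h') hc <;>
      simp only [connEdges, starEdges, testEdges] at h h'
    have hc : act (V z) i = act (V z') i' := e.injective hc
    obtain rfl : z = z' := by
      rcases h with ⟨h, rfl⟩ | ⟨h, rfl⟩ <;> rcases h' with ⟨h', h2'⟩ | ⟨h', h2'⟩
      · exact Fin.ext (by omega)
      · exact absurd h2' h01
      · exact absurd h2'.symm h01
      · exact Fin.ext (by omega)
    rw [act_injective _ hc]

variable {H : Type*} [AddCommGroup H] (L : Layout n k (Fin N × Wire t r) (ZMod 2) H)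

/-- `T` is a configuration of the offline algorithm with the relative permutations `V`. -/
def IsMergeConf (e : Wire t r ≃ Fin k) (V : ℕ → Fin t → ZMod 2) (T : Cache n k) : Prop :=
  ∃ (p l : ℕ) (hl : 0 < l) (d : Fin t),
    T = L.conf (isCompatible_mergeEdges e V p hl d).isProper

theorem card_filter_fin_mem_le {N : ℕ} {f : ℕ → ℕ} (hf : Function.Injective f) (s : Finset ℕ) :
    (Finset.univ.filter fun z : Fin N => f z ∈ s).card ≤ s.card :=
  Finset.card_le_card_of_injOn (fun z => f z) (fun z hz => by simpa using hz)
    fun _ _ _ _ h => Fin.ext (hf h)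

variable {L}

/-- Passing from the test of one bit to the next one takes few insertions. -/
theorem IsMergeConf.switchCost_le {e : Wire t r ≃ Fin k} {V : ℕ → Fin t → ZMod 2} {T : Cache n k}
    (hT : IsMergeConf L e V T) (p : ℕ) {l : ℕ} (hl : 0 < l) (d : Fin t) :
    T.switchCost (L.conf (isCompatible_mergeEdges e V p hl d).isProper) ≤ 7 * k := by
  classical
  obtain ⟨p', l', hl', d', rfl⟩ := hT
  have hcard : Fintype.card (Wire t r) = k := by
    simpa using Fintype.card_congr e
  let sA : Finset ℕ := {p', p' + l', p' + 2 * l', p, p + l}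
  let sB : Finset ℕ := {p + l, p + 2 * l}
  let A : Finset (Fin N × Wire t r) :=
    (Finset.univ.filter fun z : Fin N => id z.val ∈ sA) ×ˢ Finset.univ
  let B : Finset (Fin N × Wire t r) :=
    (Finset.univ.filter fun z : Fin N => z.val + 1 ∈ sB) ×ˢ Finset.univ
  have hA : A.card ≤ 5 * k := by
    rw [Finset.card_product, Finset.card_univ, hcard]
    exact Nat.mul_le_mul_right _
      ((card_filter_fin_mem_le Function.injective_id sA).trans Finset.card_le_five)
  have hB : B.card ≤ 2 * k := by
    rw [Finset.card_product, Finset.card_univ, hcard]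
    exact Nat.mul_le_mul_right _
      ((card_filter_fin_mem_le (add_left_injective 1) sB).trans Finset.card_le_two)
  refine (Layout.switchCost_conf_le _ _ ∅ A B (by simp) ?_).trans
    (by simp only [Finset.card_empty]; omega)
  rintro i a b ⟨h, hcol⟩ h'
  have h'' : ¬ mergeEdges V p' l' d' a b := fun h2 => h' ⟨h2, hcol⟩
  rcases h with h | h | h <;> rcases a with ⟨z, j⟩ | x <;> rcases b with ⟨z', j'⟩ | y <;>
    simp only [connEdges, starEdges, testEdges] at h
  · left
    refine ⟨_, ?_, rfl⟩
    simp only [A, sA, Finset.mem_product, Finset.mem_filter, Finset.mem_univ, true_and, and_true,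
      Finset.mem_insert, Finset.mem_singleton, id]
    by_contra hne
    refine h'' (Or.inl ⟨h.1, ?_, h.2.2⟩)
    omega
  · left
    refine ⟨_, ?_, rfl⟩
    simp only [A, sA, Finset.mem_product, Finset.mem_filter, Finset.mem_univ, true_and, and_true,
      Finset.mem_insert, Finset.mem_singleton, id]
    omega
  · right
    refine ⟨_, ?_, rfl⟩
    simp only [B, sB, Finset.mem_product, Finset.mem_filter, Finset.mem_univ, true_and, and_true,
      Finset.mem_insert, Finset.mem_singleton]
    omega

/-- Changing the relative permutations costs a constant per gadget. -/
theorem IsMergeConf.switchCost_change_le {e : Wire t r ≃ Fin k} {V V' : ℕ → Fin t → ZMod 2}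
    {T T' : Cache n k} (hT : IsMergeConf L e V T) (hT' : IsMergeConf L e V' T') :
    T.switchCost T' ≤ 11 * (N * k) := by
  classical
  obtain ⟨p, l, hl, d, rfl⟩ := hT
  obtain ⟨p', l', hl', d', rfl⟩ := hT'
  have hcard : Fintype.card (Wire t r) = k := by
    simpa using Fintype.card_congr e
  refine (Layout.switchCost_conf_le _ _ Finset.univ Finset.univ Finset.univ (by simp) ?_).trans
    (by simp only [Finset.card_univ, Fintype.card_prod, Fintype.card_fin, hcard]; omega)
  rintro i a b ⟨h, hcol⟩ -
  rcases h with h | h | h <;> rcases a with ⟨z, j⟩ | x <;> rcases b with ⟨z', j'⟩ | y <;>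
    simp only [connEdges, starEdges, testEdges] at h <;> simp

variable (L) in
/-- The requests that show the bundles on `[p, p + l)` and `[p + l, p + 2 * l)`. -/
noncomputable def homeList [Fintype H] (V : ℕ → Fin t → ZMod 2) (p l : ℕ) : List (Edge n) :=
  L.network (fun g => p ≤ g.1.val ∧ g.1.val < p + 2 * l) (homeEdges V p l)

variable (L) in
/-- The requests that test the bit `d` of the relative permutation. -/
noncomputable def testList [Fintype H] (V : ℕ → Fin t → ZMod 2) (p l : ℕ) (d : Fin t)
    (β : ZMod 2) : List (Edge n) :=
  L.network (fun g => p ≤ g.1.val ∧ g.1.val < p + 2 * l)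
    fun a b => homeEdges V p l a b ∨ testEdges p l d β a b

/-- The requests depend only on the differences of the bit vectors within the two bundles and on
one bit of the difference between the bundles, so the offline algorithm can serve them with any
bit vectors that agree in these respects. -/
theorem conf_contains_request [Fintype H] (e : Wire t r ≃ Fin k) {V v : ℕ → Fin t → ZMod 2}
    {w₁ w₂ : Fin t → ZMod 2} {p l : ℕ} (hl : 0 < l) (d : Fin t) {β : ZMod 2}
    (h₁ : ∀ z, p ≤ z → z < p + l → V z = v z + w₁)
    (h₂ : ∀ z, p + l ≤ z → z < p + 2 * l → V z = v z + w₂)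
    (hβ : (v (p + l - 1) + v (p + 2 * l - 1)) d + (w₁ d + w₂ d) = β) {f : Edge n}
    (hf : f ∈ homeList L v p l ∨ f ∈ testList L v p l d β) :
    (L.conf (isCompatible_mergeEdges e V p hl d).isProper).Contains f := by
  have hhome : ∀ a b, homeEdges (N := N) (r := r) v p l a b → mergeEdges V p l d a b := by
    rintro (⟨z, i⟩ | x) (⟨z', i'⟩ | y) (h | h)
    · obtain ⟨hz, hP, ha⟩ := h
      refine Or.inl ⟨hz, by omega, ?_⟩
      rcases lt_or_ge z.val (p + l) with hlt | hge
      · rw [h₁ z (by omega) hlt, h₁ z' (by omega) (by omega), add_comm, ← act_act, ha, act_act,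
          add_comm]
      · rw [h₂ z (by omega) (by omega), h₂ z' (by omega) (by omega), add_comm, ← act_act, ha,
          act_act, add_comm]
    all_goals first | exact h.elim | exact Or.inr (Or.inl h)
  have htest : ∀ a b, testEdges (N := N) (r := r) p l d β a b → mergeEdges V p l d a b := by
    intro a b h
    refine Or.inr (Or.inr ?_)
    convert h
    rw [h₁ _ (by omega) (by omega), h₂ _ (by omega) (by omega), ← hβ]
    simp only [Pi.add_apply]
    ring
  rcases hf with hf | hf
  · rcases Layout.mem_network_cases hf with ⟨g, h, i, hi, rfl⟩ | ⟨a, b, h, rfl⟩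
    · exact Layout.conf_containsGadget _ g h i hi
    · exact (isCompatible_mergeEdges e V p hl d).contains (hhome _ _ h)
  · rcases Layout.mem_network_cases hf with ⟨g, h, i, hi, rfl⟩ | ⟨a, b, h, rfl⟩
    · exact Layout.conf_containsGadget _ g h i hi
    · exact (isCompatible_mergeEdges e V p hl d).contains (h.elim (hhome _ _) (htest _ _))

end bundles

section bundles

variable {N t r : ℕ} {H : Type*} [AddCommGroup H] [Fintype H]
  {L : Layout n k (Fin N × Wire t r) (ZMod 2) H}

/-! ### The cost of a random bit -/

/-- The gadget at the position `z` of the track `w`. -/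
def track (V : ℕ → Fin t → ZMod 2) (z : Fin N) (w : Wire t r) : Fin N × Wire t r :=
  (z, act (V z) w)

theorem track_injective (V : ℕ → Fin t → ZMod 2) {z z' : Fin N} {w w' : Wire t r}
    (h : track V z w = track V z' w') : z = z' ∧ w = w' := by
  simp only [track, Prod.mk.injEq] at h
  obtain ⟨rfl, h⟩ := h
  exact ⟨rfl, act_injective _ h⟩

variable {V : ℕ → Fin t → ZMod 2} {p l : ℕ} {S T : Cache n k}

theorem color_track_eq (hS : ∀ f ∈ homeList L V p l, S.Contains f) {q : ℕ}
    (hq : q = p ∨ q = p + l) (w : Wire t r) (z₀ z : Fin N) (h₀ : z₀.val = q) (h₁ : q ≤ z.val)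
    (h₂ : z.val < q + l) : L.color S (track V z w) = L.color S (track V z₀ w) := by
  obtain ⟨y, hy⟩ := Nat.exists_eq_add_of_le h₁
  induction y generalizing z with
  | zero =>
    obtain rfl : z = z₀ := Fin.ext (by omega)
    rfl
  | succ y ih =>
    rw [← ih ⟨q + y, by omega⟩ (by simp) (by simp only; omega) rfl]
    have hS := Layout.forall_mem_network.1 hS
    refine (Layout.color_eq_of_connector (hS.1 _ ?_) (hS.1 _ ?_) (hS.2 _ _ ?_)).symm
    · simp only [track]; omega
    · simp only [track]; omega
    · refine Or.inl ⟨?_, ?_, ?_⟩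
      · simp only; omega
      · omega
      · rw [act_self, act_self]

theorem color_start_injective (hS : ∀ f ∈ homeList L V p l, S.Contains f) (hl : 0 < l) {q : ℕ}
    (hq : q = p ∨ q = p + l) (z₀ : Fin N) (h₀ : z₀.val = q) :
    Function.Injective fun w => L.color S (track V z₀ w) := by
  intro w w' h
  have hS := Layout.forall_mem_network.1 hS
  have hQ : ∀ w : Wire t r, p ≤ (track V z₀ w).1.val ∧ (track V z₀ w).1.val < p + 2 * l := by
    intro w
    simp only [track]
    omega
  refine (track_injective V (Layout.eq_of_color_eq_of_star_out
    (q := .inr (if q = p then 0 else 1)) (hS.1 _ (hQ w)) (hS.1 _ (hQ w'))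
    (hS.2 _ _ (Or.inr ?_)) (hS.2 _ _ (Or.inr ?_)) h)).2
  all_goals
    simp only [starEdges, track]
    split_ifs with hp
    · exact Or.inl ⟨h₀.trans hp, rfl⟩
    · exact Or.inr ⟨h₀.trans (hq.resolve_left hp), rfl⟩

/-- While a bit is tested, tracks of the two bundles that have the same colour have the same
bit. -/
theorem label_eq_of_color_eq {d : Fin t} {β : ZMod 2}
    (hT : ∀ f ∈ testList L V p l d β, T.Contains f) (hl : 0 < l) {z₁ z₂ : Fin N}
    (h₁ : z₁.val + 1 = p + l) (h₂ : z₂.val + 1 = p + 2 * l) {w w' : Wire t r}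
    (h : L.color T (track V z₁ w) = L.color T (track V z₂ w')) :
    label d (V z₁ d) w = label d (β + V z₂ d) w' := by
  by_contra hne
  have hT := Layout.forall_mem_network.1 hT
  have h3 : label d (β + V z₂ d) w' = label d (V z₁ d) w + 1 := by
    generalize label d (V z₁ d) w = x at hne ⊢
    generalize label d (β + V z₂ d) w' = y at hne ⊢
    revert x y
    decide
  have e := Layout.eq_of_color_eq_of_star_in (p := .inr (label d (V z₁ d) w))
    (hT.1 _ ?_) (hT.1 _ ?_) (hT.2 _ _ (Or.inr (Or.inl ⟨h₁, ?_⟩)))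
    (hT.2 _ _ (Or.inr (Or.inr ⟨h₂, ?_⟩))) h
  · have := congrArg Fin.val (track_injective V e).1
    omega
  · simp only [track]; omega
  · simp only [track]; omega
  · rw [track, label_act, zero_add]
  · rw [track, label_act, h3]

theorem contains_home_of_test {d : Fin t} {β : ZMod 2}
    (hT : ∀ f ∈ testList L V p l d β, T.Contains f) : ∀ f ∈ homeList L V p l, T.Contains f := by
  have hT := Layout.forall_mem_network.1 hT
  exact Layout.forall_mem_network.2 ⟨hT.1, fun a b h => hT.2 a b (Or.inl h)⟩

/-- Every wire of the second bundle whose colour does not pass the test forces a recolouring of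
its track in the second bundle, or of the track of the same colour in the first bundle. -/
theorem mul_card_le_switchCost (hN : p + 2 * l ≤ N) (hl : 0 < l) {d : Fin t} {β : ZMod 2}
    (hS : ∀ f ∈ homeList L V p l, S.Contains f)
    (hT : ∀ f ∈ testList L V p l d β, T.Contains f) {ρ : Wire t r → Wire t r}
    (hρ : Function.Injective ρ)
    (hSρ : ∀ w, L.color S (track V ⟨p, by omega⟩ (ρ w)) =
      L.color S (track V ⟨p + l, by omega⟩ w)) :
    l * (Finset.univ.filter fun w =>
      label d (V (p + l - 1) d) (ρ w) ≠ label d (β + V (p + 2 * l - 1) d) w).card ≤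
        S.switchCost T := by
  classical
  have hT' := contains_home_of_test hT
  let q : Bool → ℕ := fun b => if b then p + l else p
  have hq : ∀ b, q b = p ∨ q b = p + l := by rintro (_ | _) <;> simp [q]
  have hqN : ∀ b, q b + l ≤ N := by rintro (_ | _) <;> simp only [q] <;> grind
  let z₀ : Bool → Fin N := fun b => ⟨q b, by have := hqN b; omega⟩
  -- the tracks that change their colour
  let C : Bool → Finset (Wire t r) := fun b => Finset.univ.filter fun w =>
    L.color S (track V (z₀ b) w) ≠ L.color T (track V (z₀ b) w)
  let D : Finset ((Bool × Wire t r) × Fin l) :=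
    (Finset.univ.filter fun x : Bool × Wire t r => x.2 ∈ C x.1) ×ˢ Finset.univ
  let γ : (Bool × Wire t r) × Fin l → Fin N × Wire t r := fun x =>
    track V ⟨q x.1.1 + x.2.val, by have := hqN x.1.1; have := x.2.2; omega⟩ x.1.2
  have hγ : Function.Injective γ := by
    rintro ⟨⟨b, w⟩, y⟩ ⟨⟨b', w'⟩, y'⟩ h
    obtain ⟨h1, h2⟩ := track_injective V h
    have h1 : q b + y.val = q b' + y'.val := congrArg Fin.val h1
    have hy := y.2
    have hy' := y'.2
    have hb : b = b' ∧ y = y' := by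
      rcases b with _ | _ <;> rcases b' with _ | _ <;> simp only [q] at h1 <;> grind
    simp only at h2
    rw [h2, hb.1, hb.2]
  have hcost : (D.image γ).card ≤ S.switchCost T := by
    refine Layout.card_le_switchCost_of_color_ne (L := L) _ ?_ ?_ ?_
    all_goals
      intro g hg
      obtain ⟨⟨⟨b, w⟩, y⟩, hD, rfl⟩ := Finset.mem_image.1 hg
      simp only [D, C, Finset.mem_product, Finset.mem_filter, Finset.mem_univ, true_and,
        and_true] at hD
      have hy := y.2
      have hqb := hq b
    · exact (Layout.forall_mem_network.1 hS).1 _ (by simp only [γ, track]; omega)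
    · exact (Layout.forall_mem_network.1 hT').1 _ (by simp only [γ, track]; omega)
    · rw [color_track_eq hS hqb w (z₀ b) _ rfl (by simp only; omega) (by simp only; omega),
        color_track_eq hT' hqb w (z₀ b) _ rfl (by simp only; omega) (by simp only; omega)]
      exact hD
  refine le_trans ?_ hcost
  rw [Finset.card_image_of_injective _ hγ, Finset.card_product, Finset.card_univ,
    Fintype.card_fin, mul_comm]
  refine Nat.mul_le_mul_right _ ?_
  -- each wire that fails the test is charged to a changed track
  refine Finset.card_le_card_of_injOn
    (fun w => if w ∈ C true then (true, w) else (false, ρ w)) ?_ ?_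
  · intro w hw
    have hw : label d (V (p + l - 1) d) (ρ w) ≠ label d (β + V (p + 2 * l - 1) d) w := by
      simpa using hw
    simp only [Finset.coe_filter, Finset.mem_univ, true_and, Set.mem_ofPred_eq]
    by_cases h2 : w ∈ C true
    · rwa [if_pos h2]
    · rw [if_neg h2]
      by_contra h1
      simp only [C, Finset.mem_filter, Finset.mem_univ, true_and, not_not] at h1 h2
      refine hw ?_
      have e : L.color T (track V (z₀ false) (ρ w)) = L.color T (track V (z₀ true) w) := by
        rw [← h1, ← h2]
        exact hSρ w
      have hz₁ : p + l - 1 < N := by omega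
      have hz₂ : p + 2 * l - 1 < N := by omega
      refine label_eq_of_color_eq (z₁ := ⟨_, hz₁⟩) (z₂ := ⟨_, hz₂⟩) hT hl
        (by simp only; omega) (by simp only; omega) ?_
      rw [color_track_eq hT' (hq false) (ρ w) (z₀ false) _ rfl (by simp [q]; omega)
          (by simp [q]; omega),
        color_track_eq hT' (hq true) w (z₀ true) _ rfl (by simp [q]; omega)
          (by simp [q]; omega), e]
  · intro w _ w' _ h
    simp only at h
    split_ifs at h <;> simp only [Prod.mk.injEq, Bool.true_eq_false, Bool.false_eq_true, false_and,
      true_and] at h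
    · exact h
    · exact hρ h

/-- For every wire of the first kind exactly one value of the tested bit is wrong. -/
theorem two_pow_le_sum_card (d : Fin t) (x y : ZMod 2) (ρ : Wire t r → Wire t r) :
    2 ^ t ≤ ∑ β : ZMod 2,
      (Finset.univ.filter fun w => label d x (ρ w) ≠ label d (β + y) w).card := by
  simp only [Finset.card_filter]
  rw [Finset.sum_comm]
  have h1 : ∀ w : Fin t → ZMod 2, 1 ≤ ∑ β : ZMod 2,
      (if label d x (ρ (.inl w)) ≠ label d (β + y) (.inl w : Wire t r) then 1 else 0) := by
    intro w
    have hb : ∀ a b c : ZMod 2, ∃ β, a ≠ b + (β + c) := by decide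
    obtain ⟨β, hβ⟩ := hb (label d x (ρ (.inl w))) (w d) y
    refine le_trans ?_ (Finset.single_le_sum (fun _ _ => Nat.zero_le _) (Finset.mem_univ β))
    rw [if_pos]
    exact hβ
  rw [Fintype.sum_sum_type]
  refine le_trans ?_ (Nat.le_add_right _ _)
  refine le_trans ?_ (Finset.sum_le_sum fun w _ => h1 w)
  simp [ZMod.card]

variable (L) in
/-- The requests for a tested bit: the two bundles are shown, and then the bit is tested, with
repetitions. -/
noncomputable def bitRequests (V : ℕ → Fin t → ZMod 2) (p l : ℕ) (d : Fin t) (β : ZMod 2) :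
    List (Edge n) :=
  rounds (l * k) (homeList L V p l) ++ rounds (l * k) (testList L V p l d β)

/-- A random tested bit costs any algorithm at least `l * 2 ^ t / 2` in expectation. -/
theorem DetAlg.le_sum_cost_bitRequests (A : DetAlg n k) (e : Wire t r ≃ Fin k)
    (hN : p + 2 * l ≤ N) (hl : 0 < l) (d : Fin t) (σ : List (Edge n)) :
    2 * A.cost σ + l * 2 ^ t ≤ ∑ β : ZMod 2, A.cost (σ ++ bitRequests L V p l d β) := by
  have hcard : Fintype.card (Wire t r) = k := by
    simpa using Fintype.card_congr e
  -- it suffices to bound the cost for either bit by the number of wires that fail the test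
  suffices h : ∃ ρ : Wire t r → Wire t r, ∀ β : ZMod 2, A.cost σ + l * (Finset.univ.filter fun w =>
      label d (V (p + l - 1) d) (ρ w) ≠ label d (β + V (p + 2 * l - 1) d) w).card ≤
        A.cost (σ ++ bitRequests L V p l d β) by
    obtain ⟨ρ, h⟩ := h
    refine le_trans ?_ (Finset.sum_le_sum fun β _ => h β)
    rw [Finset.sum_add_distrib, ← Finset.mul_sum, Finset.sum_const, Finset.card_univ, ZMod.card,
      smul_eq_mul]
    exact Nat.add_le_add_left (Nat.mul_le_mul_left _ (two_pow_le_sum_card d _ _ ρ)) _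
  have hle : ∀ (ρ : Wire t r → Wire t r) (β : ZMod 2), l * (Finset.univ.filter fun w =>
      label d (V (p + l - 1) d) (ρ w) ≠ label d (β + V (p + 2 * l - 1) d) w).card ≤ l * k :=
    fun ρ β => Nat.mul_le_mul_left _ ((Finset.card_le_univ _).trans hcard.le)
  rcases A.exists_contains_of_rounds (homeList L V p l) (l * k) σ with h | ⟨τ, τ', hτ, hS⟩
  · refine ⟨id, fun β => (Nat.add_le_add_left (hle _ β) _).trans (h.trans ?_)⟩
    rw [bitRequests, ← List.append_assoc]
    exact A.cost_le_append _ _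
  · have hz₁ : p < N := by omega
    have hz₂ : p + l < N := by omega
    have hinj₁ := color_start_injective hS hl (Or.inl rfl) ⟨p, hz₁⟩ rfl
    have hinj₂ := color_start_injective hS hl (Or.inr rfl) ⟨p + l, hz₂⟩ rfl
    have hsurj := ((Fintype.bijective_iff_injective_and_card _).2
      ⟨hinj₁, by rw [hcard, Fintype.card_fin]⟩).2
    choose ρ hρ using fun w =>
      hsurj (L.color (A.state (σ ++ τ)) (track V ⟨p + l, hz₂⟩ w))
    have hρinj : Function.Injective ρ := fun w w' hw => hinj₂ (by
      simp only
      rw [← hρ w, ← hρ w', hw])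
    refine ⟨ρ, fun β => ?_⟩
    have hmono := A.cost_le_append σ (rounds (l * k) (homeList L V p l))
    rcases A.exists_contains_of_rounds (testList L V p l d β) (l * k)
      (σ ++ rounds (l * k) (homeList L V p l)) with h | ⟨τ₁, τ₂, hτ₁, hT⟩
    · have := hle ρ β
      rw [bitRequests, ← List.append_assoc]
      omega
    · have h1 := mul_card_le_switchCost hN hl hS hT hρinj hρ
      have h2 := A.cost_le_append σ τ
      have e1 : σ ++ bitRequests L V p l d β = (σ ++ τ ++ (τ' ++ τ₁)) ++ τ₂ := by
        rw [bitRequests, hτ₁, hτ]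
        simp only [List.append_assoc]
      have e2 : σ ++ rounds (l * k) (homeList L V p l) ++ τ₁ = σ ++ τ ++ (τ' ++ τ₁) := by
        rw [hτ]
        simp only [List.append_assoc]
      rw [e2] at h1
      have h3 := A.cost_add_switchCost_le (σ ++ τ) (τ' ++ τ₁)
      have h4 := A.cost_le_append (σ ++ τ ++ (τ' ++ τ₁)) τ₂
      rw [e1]
      omega

end bundles

section bundles

variable {N t r : ℕ} {H : Type*} [AddCommGroup H] [Fintype H]
  {L : Layout n k (Fin N × Wire t r) (ZMod 2) H}

/-! ### Merging bundles -/

/-- The adversary tests the bits below `m` of the permutation that joins two adjacent bundles. The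
bits `b` come out as chosen by the adversary; the offline algorithm knows them in advance, and only
has to hold bundles whose relative permutation has these bits. -/
theorem RandAlg.exists_merge_bits (A : RandAlg.{u} n k) (e : Wire t r ≃ Fin k) {p l : ℕ}
    (hN : p + 2 * l ≤ N) (hl : 0 < l) (v : ℕ → Fin t → ZMod 2) (σ : List (Edge n)) (m : ℕ)
    (hm : m ≤ t) :
    ∃ (τ : List (Edge n)) (b : Fin t → ZMod 2),
      A.expectedCost σ + m * ((l * 2 ^ t : ℕ) / 2 : ℝ) ≤ A.expectedCost (σ ++ τ) ∧
      ∀ (V : ℕ → Fin t → ZMod 2) (w₁ w₂ : Fin t → ZMod 2),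
        (∀ z, p ≤ z → z < p + l → V z = v z + w₁) →
        (∀ z, p + l ≤ z → z < p + 2 * l → V z = v z + w₂) →
        (∀ d : Fin t, d.val < m → w₁ d + w₂ d = b d) →
        ∀ T, IsMergeConf L e V T → ∃ T', IsMergeConf L e V T' ∧ Serves T τ (m * (7 * k)) T' := by
  induction m with
  | zero =>
    exact ⟨[], 0, by simp, fun V w₁ w₂ _ _ _ T hT => ⟨T, hT, by simpa using Serves.nil T⟩⟩
  | succ m ih =>
    obtain ⟨τ, b, hc, hS⟩ := ih (by omega)
    let d : Fin t := ⟨m, hm⟩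
    obtain ⟨β, hβ⟩ := A.exists_continuation (σ ++ τ) (fun β => bitRequests L v p l d β)
      ((l * 2 ^ t : ℕ) / 2 : ℝ) (by
      intro D
      have h := D.le_sum_cost_bitRequests (L := L) (V := v) e hN hl d (σ ++ τ)
      have h' := (Nat.cast_le (α := ℝ)).2 h
      rw [Finset.sum_sub_distrib, Finset.sum_const, Finset.card_univ, ZMod.card, nsmul_eq_mul]
      push_cast at h' ⊢
      linarith)
    let b' := Function.update b d (β + (v (p + l - 1) + v (p + 2 * l - 1)) d)
    refine ⟨τ ++ bitRequests L v p l d β, b', ?_, fun V w₁ w₂ h₁ h₂ hb T hT => ?_⟩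
    · rw [← List.append_assoc]
      push_cast at hβ hc ⊢
      linarith
    · obtain ⟨T', hT', hTT'⟩ := hS V w₁ w₂ h₁ h₂ (fun d' hd' => by
        rw [hb d' (by omega)]
        refine Function.update_of_ne ?_ _ _
        rintro rfl
        simp [d] at hd') T hT
      refine ⟨L.conf (isCompatible_mergeEdges e V p hl d).isProper, ⟨p, l, hl, d, rfl⟩, ?_⟩
      have hbd : w₁ d + w₂ d = β + (v (p + l - 1) + v (p + 2 * l - 1)) d := by
        rw [hb d (by simp [d])]
        exact Function.update_self _ _ _
      refine ((hTT'.move _ (hT'.switchCost_le p hl d)).trans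
        (Serves.of_contains (bitRequests L v p l d β) fun f hf => ?_)).mono
          (by rw [Nat.add_mul m 1, one_mul, add_zero])
      refine conf_contains_request e hl d h₁ h₂ (β := β) ?_ ?_
      · rw [hbd, add_left_comm, CharTwo.add_self_eq_zero, add_zero]
      · rw [bitRequests, List.mem_append] at hf
        exact hf.imp mem_of_mem_rounds mem_of_mem_rounds

/-- Building a bundle of length `2 ^ j * l₀` by repeated merging. Each of the `j` levels costs the
online algorithm `2 ^ j * t * l₀ * 2 ^ t / 4`, while the offline algorithm, which knows the
resulting permutations, has the right gadget colours from the beginning and only pays for the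
edges outside of the gadgets. -/
theorem RandAlg.exists_bundle (A : RandAlg.{u} n k) (e : Wire t r ≃ Fin k) {l₀ : ℕ} (hl₀ : 0 < l₀)
    (j : ℕ) (p : ℕ) (hN : p + 2 ^ j * l₀ ≤ N) (σ : List (Edge n)) :
    ∃ (τ : List (Edge n)) (v : ℕ → Fin t → ZMod 2),
      A.expectedCost σ + j * 2 ^ j * (t * l₀ * 2 ^ t / 4) ≤ A.expectedCost (σ ++ τ) ∧
      ∀ (V : ℕ → Fin t → ZMod 2) (w : Fin t → ZMod 2),
        (∀ z, p ≤ z → z < p + 2 ^ j * l₀ → V z = v z + w) →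
        ∀ T, IsMergeConf L e V T →
          ∃ T', IsMergeConf L e V T' ∧ Serves T τ ((2 ^ j - 1) * (t * (7 * k))) T' := by
  induction j generalizing p σ with
  | zero =>
    exact ⟨[], 0, by simp, fun V w _ T hT => ⟨T, hT, by simpa using Serves.nil T⟩⟩
  | succ j ih =>
    obtain ⟨l, hl⟩ : ∃ l, l = 2 ^ j * l₀ := ⟨_, rfl⟩
    have hl2 : 2 ^ (j + 1) * l₀ = 2 * l := by rw [hl]; ring
    have hlpos : 0 < l := by rw [hl]; positivity
    rw [hl2] at hN
    simp only [hl2, ← hl] at ih ⊢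
    obtain ⟨τ₁, v₁, hc₁, hS₁⟩ := ih p (by omega) σ
    obtain ⟨τ₂, v₂, hc₂, hS₂⟩ := ih (p + l) (by omega) (σ ++ τ₁)
    let v : ℕ → Fin t → ZMod 2 := fun z => if z < p + l then v₁ z else v₂ z
    obtain ⟨τ₃, b, hc₃, hS₃⟩ := A.exists_merge_bits (L := L) e hN hlpos v (σ ++ τ₁ ++ τ₂) t le_rfl
    refine ⟨τ₁ ++ τ₂ ++ τ₃, fun z => if z < p + l then v₁ z else v₂ z + b, ?_,
      fun V w hV T hT => ?_⟩
    · have h1 : (l : ℝ) = 2 ^ j * l₀ := by rw [hl]; push_cast; ring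
      push_cast at hc₃ ⊢
      rw [h1] at hc₃
      rw [← List.append_assoc, ← List.append_assoc, pow_succ]
      linarith
    · have hV₁ : ∀ z, p ≤ z → z < p + l → V z = v₁ z + w := fun z h1 h2 => by
        rw [hV z h1 (by omega)]
        simp only [if_pos h2]
      have hV₂ : ∀ z, p + l ≤ z → z < p + 2 * l → V z = v₂ z + (b + w) := fun z h1 h2 => by
        rw [hV z (by omega) h2]
        simp only [if_neg (not_lt.2 h1), add_assoc]
      obtain ⟨T₁, hT₁, hs₁⟩ := hS₁ V w hV₁ T hT
      obtain ⟨T₂, hT₂, hs₂⟩ := hS₂ V (b + w) (fun z h1 h2 => hV₂ z h1 (by omega)) T₁ hT₁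
      obtain ⟨T₃, hT₃, hs₃⟩ := hS₃ V w (b + w)
        (fun z h1 h2 => by simp only [v]; rw [if_pos h2, hV₁ z h1 h2])
        (fun z h1 h2 => by simp only [v]; rw [if_neg (by omega), hV₂ z h1 h2])
        (fun d _ => by
          rw [Pi.add_apply, add_left_comm, CharTwo.add_self_eq_zero, add_zero]) T₂ hT₂
      refine ⟨T₃, hT₃, ((hs₁.trans hs₂).trans hs₃).mono (le_of_eq ?_)⟩
      obtain ⟨q, hq⟩ := Nat.exists_eq_add_of_le (Nat.one_le_two_pow (n := j))
      have hq' : 2 ^ (j + 1) = 1 + (2 * q + 1) := by rw [pow_succ, hq]; ring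
      rw [hq, hq', Nat.add_sub_cancel_left, Nat.add_sub_cancel_left]
      ring

theorem RandAlg.exists_bundle_sequence (A : RandAlg.{u} n k) (e : Wire t r ≃ Fin k) (ht : 0 < t)
    {J : ℕ} (hN : 2 ^ J * t = N) (m : ℕ) :
    ∃ (σ : List (Edge n)) (V : ℕ → Fin t → ZMod 2) (T : Cache n k),
      m * (J * 2 ^ J * (t * t * 2 ^ t / 4) : ℝ) ≤ A.expectedCost σ ∧ IsMergeConf L e V T ∧
      Serves (Cache.empty n k) σ (k * (n * n) + m * (18 * (N * k))) T := by
  induction m with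
  | zero =>
    exact ⟨[], 0, L.conf (isCompatible_mergeEdges e 0 0 one_pos ⟨0, ht⟩).isProper,
      by simpa using A.expectedCost_nonneg [], ⟨0, 1, one_pos, _, rfl⟩,
      Serves.switch (by simpa using Cache.switchCost_le_const _ _)⟩
  | succ m ih =>
    obtain ⟨σ, V, T, hc, hT, hS⟩ := ih
    obtain ⟨τ, v, hc', hS'⟩ := A.exists_bundle (L := L) e ht J 0 (by omega) σ
    have hT₁ : IsMergeConf L e v (L.conf (isCompatible_mergeEdges e v 0 one_pos ⟨0, ht⟩).isProper) :=
      ⟨0, 1, one_pos, _, rfl⟩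
    obtain ⟨T', hT', hs⟩ := hS' v 0 (fun z _ _ => (add_zero _).symm) _ hT₁
    refine ⟨σ ++ τ, v, T', by push_cast; linarith, hT',
      ((hS.move _ (hT.switchCost_change_le hT₁)).trans hs).mono ?_⟩
    have h1 : (2 ^ J - 1) * (t * (7 * k)) ≤ 7 * (N * k) := by
      rw [← hN]
      calc (2 ^ J - 1) * (t * (7 * k)) ≤ 2 ^ J * (t * (7 * k)) :=
            Nat.mul_le_mul_right _ (Nat.sub_le _ _)
        _ = 7 * (2 ^ J * t * k) := by ring
    rw [Nat.add_mul m 1, one_mul]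
    omega

end bundles

/-- If bundles of length `2 ^ J * t` fit into the graph, where `t` is the binary logarithm
of `k`, the competitive ratio is at least `J * t / 144`. -/
theorem RandAlg.le_of_isCompetitive_bundles {t r J : ℕ} (ht : 0 < t) (hJ : 0 < J)
    (hk : 2 ^ t + r = k) (hr : r < 2 ^ t)
    (hn : 2 ^ J * t * k * 2 ^ (t + 1) + 2 ≤ n) (A : RandAlg.{u} n k) (c : ℝ)
    (h : A.IsCompetitive c) : (J : ℝ) * t / 144 ≤ c := by
  obtain ⟨d, hd⟩ := h
  have hpow : 0 < 2 ^ t := Nat.pow_pos two_pos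
  have hcard : Fintype.card (Wire t r) = k := by simp [ZMod.card, hk]
  let e : Wire t r ≃ Fin k := Fintype.equivFinOfCardEq hcard
  obtain ⟨L⟩ := Layout.exists_layout (n := n) (k := k) (Γ := Fin (2 ^ J * t) × Wire t r)
    (X := ZMod 2) (t + 1) (by omega) (by rw [pow_succ]; omega)
    (by rw [Fintype.card_prod, hcard, Fintype.card_fin, ZMod.card]; exact hn)
  have hk0 : 0 < k := by omega
  have htR : (0 : ℝ) < t := by exact_mod_cast ht
  have hJR : (0 : ℝ) < J := by exact_mod_cast hJ
  have hkR : (0 : ℝ) < k := by exact_mod_cast hk0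
  have key := div_le_of_competitive (X := (J * 2 ^ J * (t * t * 2 ^ t / 4) : ℝ))
    (Y := ((18 * (2 ^ J * t * k) : ℕ) : ℝ)) (D := (k * (n * n) : ℕ)) hd (by positivity)
    (by exact_mod_cast (by positivity : 0 < 18 * (2 ^ J * t * k))) fun m => by
      obtain ⟨σ, V, T, h1, -, h2⟩ := A.exists_bundle_sequence (L := L) e ht rfl m
      refine ⟨σ, h1, ?_⟩
      have := h2.optCost_le
      rw [add_comm] at this
      exact_mod_cast this
  refine le_trans ?_ key
  have h2k : (k : ℝ) ≤ 2 * 2 ^ t := by exact_mod_cast (by omega : k ≤ 2 * 2 ^ t)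
  push_cast
  rw [div_le_div_iff₀ (by norm_num) (by positivity)]
  have h3 : (0 : ℝ) ≤ J * t * t * 2 ^ J := by positivity
  nlinarith [mul_le_mul_of_nonneg_left h2k h3]

/-! ### Choice of the parameters -/

theorem eventually_log_bounds {ε K : ℝ} (hε : 0 < ε) (hK : 0 < K) :
    ∃ N : ℕ, ∀ n : ℕ, N ≤ n →
      4 ≤ n ∧ 2 ≤ ε * Real.log n ∧ 8 * K ^ 2 * Real.log n ≤ (n : ℝ) ^ ε := by
  have h1 := (isLittleO_log_rpow_atTop hε).bound (c := 1 / (8 * K ^ 2)) (by positivity)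
  have h2 := (Real.tendsto_log_atTop.const_mul_atTop hε).eventually_ge_atTop 2
  have h3 := (tendsto_natCast_atTop_atTop (R := ℝ)).eventually (h1.and h2)
  obtain ⟨N, hN⟩ := Filter.eventually_atTop.1 h3
  refine ⟨max N 4, fun n hn => ?_⟩
  obtain ⟨ha, hb⟩ := hN n ((le_max_left _ _).trans hn)
  refine ⟨(le_max_right _ _).trans hn, hb, ?_⟩
  have hpos : (0 : ℝ) ≤ (n : ℝ) ^ ε := by positivity
  rw [Real.norm_eq_abs, Real.norm_of_nonneg hpos, div_mul_eq_mul_div, one_mul,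
    le_div_iff₀ (by positivity)] at ha
  have := le_abs_self (Real.log n)
  have h8 : (0 : ℝ) ≤ 8 * K ^ 2 := by positivity
  nlinarith

theorem RandAlg.le_of_isCompetitive_log_mul_log {ε K : ℝ}
    (hk : 2 ≤ k) (hkn : k < n) (hn4 : 4 ≤ n) (hn2 : 2 ≤ ε * Real.log n)
    (hnK : 8 * K ^ 2 * Real.log n ≤ (n : ℝ) ^ ε)
    (hkK : (k : ℝ) ≤ K * (n : ℝ) ^ ((1 : ℝ) / 2 - ε)) (A : RandAlg.{u} n k) (c : ℝ)
    (h : A.IsCompetitive c) : 1 / 576 * (ε * Real.log n * Real.log k) ≤ c := by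
  have hk0 : k ≠ 0 := by omega
  have hnR : (4 : ℝ) ≤ n := by exact_mod_cast hn4
  have hn0 : (0 : ℝ) < n := by linarith
  have hlogn : 0 < Real.log n := Real.log_pos (by linarith)
  have hlogk : 0 < Real.log k := Real.log_pos (by exact_mod_cast hk)
  have hlog2 : 1 / 2 < Real.log 2 := by linarith [Real.log_two_gt_d9]
  have hlog2' : Real.log 2 < 1 := by linarith [Real.log_two_lt_d9]
  -- `t` is the binary logarithm of `k`, and `2 ^ J` is close to `n ^ ε`
  set t := Nat.log 2 k with ht
  set J := ⌊ε * Real.log n⌋₊ with hJ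
  have htk : 2 ^ t ≤ k := Nat.pow_log_le_self 2 hk0
  have hkt : k < 2 ^ (t + 1) := Nat.lt_pow_succ_log_self one_lt_two k
  have ht1 : 1 ≤ t := Nat.log_pos one_lt_two hk
  have htR : (1 : ℝ) ≤ t := by exact_mod_cast ht1
  have hJle : (J : ℝ) ≤ ε * Real.log n := Nat.floor_le (by linarith)
  have hJge : ε * Real.log n / 2 ≤ J := by
    have := Nat.lt_floor_add_one (ε * Real.log n)
    rw [← hJ] at this
    linarith
  have hJ0 : 0 < J := by
    have : (0 : ℝ) < J := by linarith
    exact_mod_cast this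
  have hlogt : Real.log k / 2 ≤ t := by
    have h1 : Real.log k ≤ Real.log ((2 : ℝ) ^ (t + 1)) :=
      Real.log_le_log (by exact_mod_cast (by omega : 0 < k)) (by exact_mod_cast hkt.le)
    rw [Real.log_pow] at h1
    push_cast at h1
    nlinarith
  have htn : (t : ℝ) ≤ 2 * Real.log n := by
    have h1 : Real.log ((2 : ℝ) ^ t) ≤ Real.log n :=
      Real.log_le_log (by positivity) (by exact_mod_cast (htk.trans hkn.le))
    rw [Real.log_pow] at h1
    nlinarith
  have h2J : (2 : ℝ) ^ J ≤ (n : ℝ) ^ ε := by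
    calc (2 : ℝ) ^ J ≤ Real.exp 1 ^ J :=
          pow_le_pow_left₀ two_pos.le (by linarith [Real.add_one_le_exp 1]) _
      _ = Real.exp J := Real.exp_one_pow J
      _ ≤ Real.exp (Real.log n * ε) := Real.exp_le_exp.2 (by linarith)
      _ = (n : ℝ) ^ ε := (Real.rpow_def_of_pos hn0 ε).symm
  have hk2 : (k : ℝ) ^ 2 ≤ K ^ 2 * (n : ℝ) ^ (1 - 2 * ε) := by
    calc (k : ℝ) ^ 2 ≤ (K * (n : ℝ) ^ ((1 : ℝ) / 2 - ε)) ^ 2 :=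
          pow_le_pow_left₀ (by positivity) hkK 2
      _ = K ^ 2 * (n : ℝ) ^ (1 - 2 * ε) := by
          rw [mul_pow, ← Real.rpow_mul_natCast hn0.le]
          congr 2
          push_cast
          ring
  have hsize : (2 : ℝ) ^ J * t * k * 2 ^ (t + 1) + 2 ≤ n := by
    have h2t : (2 : ℝ) ^ (t + 1) ≤ 2 * k := by
      rw [pow_succ]
      have : (2 : ℝ) ^ t ≤ k := by exact_mod_cast htk
      linarith
    have e1 : (n : ℝ) ^ ε * (n : ℝ) ^ (1 - 2 * ε) * (n : ℝ) ^ ε = n := by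
      rw [← Real.rpow_add hn0, ← Real.rpow_add hn0]
      ring_nf
      exact Real.rpow_one _
    calc (2 : ℝ) ^ J * t * k * 2 ^ (t + 1) + 2
        ≤ (n : ℝ) ^ ε * (2 * Real.log n) * k * (2 * k) + 2 := by gcongr
      _ = (n : ℝ) ^ ε * (4 * Real.log n) * (k : ℝ) ^ 2 + 2 := by ring
      _ ≤ (n : ℝ) ^ ε * (4 * Real.log n) * (K ^ 2 * (n : ℝ) ^ (1 - 2 * ε)) + 2 := by gcongr
      _ = (n : ℝ) ^ ε * (n : ℝ) ^ (1 - 2 * ε) * (8 * K ^ 2 * Real.log n) / 2 + 2 := by ring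
      _ ≤ (n : ℝ) ^ ε * (n : ℝ) ^ (1 - 2 * ε) * (n : ℝ) ^ ε / 2 + 2 := by gcongr
      _ = n / 2 + 2 := by rw [e1]
      _ ≤ n := by linarith
  have key := A.le_of_isCompetitive_bundles (t := t) (r := k - 2 ^ t) (J := J) ht1 hJ0 (by omega)
    (by rw [pow_succ] at hkt; omega) (by exact_mod_cast hsize) c h
  refine le_trans ?_ key
  have := mul_le_mul hJge hlogt (by positivity) (Nat.cast_nonneg J)
  nlinarith

theorem DetAlg.le_of_isCompetitive_max (hk : 2 ≤ k) (hkn : k < n) (A : DetAlg n k) (c : ℝ)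
    (h : A.IsCompetitive c) : 1 / 84 * max ((n : ℝ) / k) k ≤ c := by
  have h1 := A.le_of_isCompetitive_paging hk hkn c h
  have hkR : (2 : ℝ) ≤ k := by exact_mod_cast hk
  have hk0 : (0 : ℝ) < k := by linarith
  suffices h2 : (n : ℝ) / k ≤ 84 * c by
    have := max_le h2 (by linarith : (k : ℝ) ≤ 84 * c)
    linarith
  rw [div_le_iff₀ hk0]
  obtain ⟨T, hT1, hT2⟩ : ∃ T, k ≤ 2 ^ T ∧ 2 ^ T ≤ 2 * k := by
    refine ⟨Nat.log 2 k + 1, (Nat.lt_pow_succ_log_self one_lt_two k).le, ?_⟩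
    rw [pow_succ, mul_comm]
    exact Nat.mul_le_mul_left _ (Nat.pow_log_le_self 2 (by omega))
  have hpos : 0 < 2 * 2 ^ T := by positivity
  -- `q` is the length of the wires
  obtain ⟨q, hq⟩ : ∃ q, q = (n - 1) / (2 * 2 ^ T) := ⟨_, rfl⟩
  have hlow : q * (2 * 2 ^ T) ≤ n - 1 := hq ▸ Nat.div_mul_le_self _ _
  have hup : n ≤ 4 * k * (q + 1) := by
    have h2 := Nat.lt_mul_div_succ (n - 1) hpos
    rw [← hq] at h2
    have h3 : 2 * 2 ^ T * (q + 1) ≤ 4 * k * (q + 1) := Nat.mul_le_mul_right _ (by omega)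
    omega
  have hupR : (n : ℝ) ≤ 4 * k * (q + 1) := by exact_mod_cast hup
  rcases lt_or_ge q 2 with hq2 | hq2
  · have : (q : ℝ) ≤ 1 := by exact_mod_cast (by omega : q ≤ 1)
    nlinarith
  · have h2 := A.le_of_isCompetitive_twoWires (m := q - 1) (T := T) hk (by omega) hT1
      (by
        rw [Nat.sub_add_cancel (by omega)]
        have : 2 * q * 2 ^ T = q * (2 * 2 ^ T) := by ring
        omega) c h
    rw [Nat.cast_sub (by omega)] at h2
    have hqR : (2 : ℝ) ≤ q := by exact_mod_cast hq2
    push_cast at h2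
    nlinarith

end CachingInMatchings

theorem mainTheorem4 :
    -- every (possibly randomized) online algorithm is `Ω(log n)`-competitive
    (∃ C : ℝ, 0 < C ∧ ∀ n k : ℕ, 2 ≤ k → k < n →
      ∀ (A : CachingInMatchings.RandAlg.{u} n k) (c : ℝ),
        A.IsCompetitive c → C * Real.log n ≤ c) ∧
    -- if `k = O(n ^ (1/2 - ε))`, it is `Ω(ε * log n * log k)`-competitive
    (∃ C : ℝ, 0 < C ∧ ∀ ε : ℝ, 0 < ε → ∀ K : ℝ, 0 < K →
      ∃ N : ℕ, ∀ n k : ℕ, N ≤ n → 2 ≤ k → k < n →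
        (k : ℝ) ≤ K * (n : ℝ) ^ ((1 : ℝ) / 2 - ε) →
          ∀ (A : CachingInMatchings.RandAlg.{u} n k) (c : ℝ),
            A.IsCompetitive c → C * (ε * Real.log n * Real.log k) ≤ c) ∧
    -- every deterministic online algorithm is `Ω(max (n / k) k)`-competitive
    (∃ C : ℝ, 0 < C ∧ ∀ n k : ℕ, 2 ≤ k → k < n →
      ∀ (A : CachingInMatchings.DetAlg n k) (c : ℝ),
        A.IsCompetitive c → C * max ((n : ℝ) / (k : ℝ)) (k : ℝ) ≤ c) := by
  refine ⟨?_, ⟨1 / 576, by norm_num, fun ε hε K hK => ?_⟩,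
    ⟨1 / 84, by norm_num, fun n k hk hkn A c h => A.le_of_isCompetitive_max hk hkn c h⟩⟩
  · obtain ⟨N, hN⟩ := CachingInMatchings.eventually_log_bounds (ε := 1 / 4) (K := 1)
      (by norm_num) one_pos
    have hN0 : (0 : ℝ) < 12 * (N + 1) := by positivity
    refine ⟨min (1 / 4608) (1 / (12 * (N + 1))), lt_min (by norm_num) (by positivity),
      fun n k hk hkn A c h => ?_⟩
    have h1 := A.le_of_isCompetitive_paging hk hkn c h
    have hn0 : (0 : ℝ) < n := by exact_mod_cast (by omega : 0 < n)
    have hlogn : 0 ≤ Real.log n := Real.log_natCast_nonneg n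
    have hlog2 : 1 / 2 < Real.log 2 := by linarith [Real.log_two_gt_d9]
    have hlogk : 1 / 2 < Real.log k := hlog2.trans_le
      (Real.log_le_log two_pos (by exact_mod_cast hk))
    have hC : ∀ x : ℝ, min (1 / 4608) (1 / (12 * ((N : ℝ) + 1))) ≤ x → x * Real.log n ≤ c →
        min (1 / 4608) (1 / (12 * ((N : ℝ) + 1))) * Real.log n ≤ c := fun x hx hxc =>
      (mul_le_mul_of_nonneg_right hx hlogn).trans hxc
    rcases lt_or_ge n N with hlt | hge
    · -- finitely many `n` are covered by a positive constant
      refine hC _ (min_le_right _ _) ?_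
      have h2 : Real.log n ≤ N + 1 := by
        have := Real.log_le_sub_one_of_pos hn0
        have : (n : ℝ) ≤ N := by exact_mod_cast hlt.le
        linarith
      rw [div_mul_eq_mul_div, one_mul, div_le_iff₀ hN0]
      nlinarith
    · obtain ⟨hn4, hn2, hnK⟩ := hN n hge
      refine hC _ (min_le_left _ _) ?_
      rcases le_or_gt (k : ℝ) (1 * (n : ℝ) ^ ((1 : ℝ) / 2 - 1 / 4)) with hle | hgt
      · have h2 := A.le_of_isCompetitive_log_mul_log hk hkn hn4 hn2 hnK hle c h
        nlinarith
      · have h2 : Real.log ((n : ℝ) ^ ((1 : ℝ) / 2 - 1 / 4)) ≤ Real.log k :=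
          Real.log_le_log (by positivity) (by linarith)
        rw [Real.log_rpow hn0] at h2
        linarith
  · obtain ⟨N, hN⟩ := CachingInMatchings.eventually_log_bounds hε hK
    refine ⟨N, fun n k hn hk hkn hkK A c h => ?_⟩
    obtain ⟨hn4, hn2, hnK⟩ := hN n hn
    exact A.le_of_isCompetitive_log_mul_log hk hkn hn4 hn2 hnK hkK c h
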